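/- Let $d\ge 1$ and let two parties, Alice and Bob, share a state $\varrho$ on $\mathbb C^d\otimes\mathbb C^d$ (a positive semidefinite matrix of trace one). It is *strictly mixed* if it is not of the form $|\psi\rangle\langle\psi|$. **Classes of operations.** An LOCC operation is *one-way from a party* if that party measures and sends the outcome to the other party, who then applies a trace-preserving channel that may depend on the outcome. It is *two-way* (bilocal) if it consists of finitely many rounds, in each of which one party measures and announces the outcome, and all later steps may depend on the outcomes so far. It is *trace-preserving* if all outcomes are kept. It is *conclusive* if outcomes may be discarded (success occurs with some probability): in the two-way case in any round, in the one-way case only by the party who sends the messages. Conclusive operations include the trace-preserving ones. A class $\mathcal C$ is given by the allowed communication (one-way from Alice, one-way from Bob, two-way) and by the kind (trace-preserving, conclusive). **Quantities.** Let $|\Psi_+\rangle=d^{-1/2}\sum_i|i\rangle\otimes|i\rangle$ and $$F_{\max}^{\mathcal C}(\varrho)=\sup_{\Lambda}\frac{\langle\Psi_+|\Lambda(\varrho)|\Psi_+\rangle}{\operatorname{Tr}\Lambda(\varrho)},$$ over the operations $\Lambda\in\mathcal C$ with $d\otimes d$ output and $\operatorname{Tr}\Lambda(\varrho)>0$. For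 a sender $s$ (Alice or Bob), a teleportation protocol is an operation $T\in\mathcal C$ in which the sender holds, besides her or his part of $\varrho$, a system $\mathbb C^d$ in an unknown pure state $\psi$, and after which the sender keeps nothing and the receiver has a system $\mathbb C^d$. For input $\psi$ let $T_\varrho(\psi)$ be the (unnormalized) output on $|\psi\rangle\langle\psi|\otimes\varrho$. With $d\psi$ the uniform probability measure on unit vectors, the fidelity of $T$ is its mean fidelity conditional on success, $$f(T)=\frac{\int\langle\psi|T_\varrho(\psi)|\psi\rangle\,d\psi}{\int\operatorname{Tr}T_\varrho(\psi)\,d\psi},$$ and $f_{\max}^{\mathcal C,s}(\varrho)$ is the supremum of $f(T)$ over the protocols $T\in\mathcal C$ with nonzero success probability (the denominator). **Theorem.** 1. For each of the six classes $\mathcal C$, the twirling $X\mapsto\int_{U(d)}(U\otimes U^*)X(U\otimes U^*)^\dagger\,dU$ (Haar measure) belongs to $\mathcal C$, and an operation in $\mathcal C$ with $d\otimes d$ output remains in $\mathcal C$ when it is followed by this twirling. 2. All suprema above are over nonempty bounded sets. For both kinds, and whenever the communication is two-way or one-way from the sender $s$, $$f_{\max}^{\mathcal C,s}(\varrho)=\frac{d\,F_{\max}^{\mathcal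 C}(\varrho)+1}{d+1}.$$ 3. For every class $\mathcal C$ and each sender $s$, if $F_{\max}^{\mathcal C}(\varrho)\le F_{th}<1$, then $$f_{\max}^{\mathcal C,s}(\varrho)\le\frac{d\,F_{\max}^{\mathcal C}(\varrho)+1}{d+1}\le\frac{d\,F_{th}+1}{d+1}=:f_{th}<1.$$ 4. If $\varrho$ is strictly mixed, then such an $F_{th}<1$, and hence a threshold $f_{th}<1$, exists in each of these cases: $\varrho$ has full rank (any class); the operations are trace-preserving; the communication is one-way (in either direction, conclusive or not). 5. In particular, let $\varrho$ be strictly mixed and let $s$ be the sender of the unknown state. There is $f_{th}<1$ such that no two-way conclusive protocol with nonzero success probability and fidelity greater than $f_{th}$ can be performed with one-way communication from $s$ only: arbitrarily good teleportation through $\varrho$, even conclusive, needs classical communication backward, from the receiver to the sender. -/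

import Mathlib

open MeasureTheory
open scoped Matrix Kronecker ComplexOrder

noncomputable section

/-! ### Bipartite states -/

/-- The symmetric maximally entangled vector `d^{-1/2} ∑ i, |i⟩ ⊗ |i⟩`. -/
def maxEntVec (d : ℕ) : Fin d × Fin d → ℂ :=
  fun p => if p.1 = p.2 then ((1 / Real.sqrt d : ℝ) : ℂ) else 0

/-- A density matrix. -/
def IsState {p : Type} [Fintype p] (ρ : Matrix p p ℂ) : Prop :=
  ρ.PosSemidef ∧ ρ.trace = 1

/-- A strictly mixed matrix: it is not a rank-one projector `|ψ⟩⟨ψ|`. -/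
def IsStrictlyMixed {p : Type} (ρ : Matrix p p ℂ) : Prop :=
  ∀ ψ : p → ℂ, ρ ≠ Matrix.vecMulVec ψ (star ψ)

/-- The overlap `⟨Ψ₊|σ|Ψ₊⟩`. -/
def singletFraction {d : ℕ} (σ : Matrix (Fin d × Fin d) (Fin d × Fin d) ℂ) : ℝ :=
  (star (maxEntVec d) ⬝ᵥ (σ *ᵥ maxEntVec d)).re

/-! ### Local operations and classical communication

The local systems of Alice and Bob are indexed by `a`, `b` before and `a'`, `b'` after an
operation; an operation is a linear map of matrices on the joint system. -/

/-- Linear maps from operators on `ℂ^a ⊗ ℂ^b` to operators on `ℂ^a' ⊗ ℂ^b'`. -/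
abbrev BiMap (a b a' b' : Type) : Type :=
  Matrix (a × b) (a × b) ℂ →ₗ[ℂ] Matrix (a' × b') (a' × b') ℂ

/-- The map `X ↦ K X Kᴴ`. -/
def krausMap {p q : Type} [Fintype p] (K : Matrix q p ℂ) :
    Matrix p p ℂ →ₗ[ℂ] Matrix q q ℂ where
  toFun X := K * X * Kᴴ
  map_add' X Y := by rw [Matrix.mul_add, Matrix.add_mul]
  map_smul' c X := by rw [Matrix.mul_smul, Matrix.smul_mul, RingHom.id_apply]

/-- Trace-preserving (deterministic) or conclusive (probabilistic) operations. The conclusive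
ones include the trace-preserving ones. -/
inductive OpKind
  | tracePreserving
  | conclusive

/-- `K` lists the Kraus operators of the outcomes that are kept in a measurement on one system:
all outcomes (`∑ Kᵢᴴ Kᵢ = 1`) in the trace-preserving case; in the conclusive case some outcomes
may be discarded (`∑ Kᵢᴴ Kᵢ ≤ 1`). -/
def IsInstrument {p q : Type} [Fintype q] [DecidableEq p] (k : OpKind) {n : ℕ}
    (K : Fin n → Matrix q p ℂ) : Prop :=
  match k with
  | .tracePreserving => ∑ i, (K i)ᴴ * K i = 1
  | .conclusive => (1 - ∑ i, (K i)ᴴ * K i).PosSemidef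

/-- One-way LOCC with messages from Alice to Bob only. Alice performs a measurement, of which she
may discard outcomes in the conclusive case; Bob applies a channel depending on her outcome. Bob's
channel is trace-preserving in both cases, as he cannot tell Alice about a failure. -/
def IsAliceToBob (k : OpKind) {a b a' b' : Type} [Fintype a] [Fintype b] [Fintype a'] [Fintype b']
    [DecidableEq a] [DecidableEq b] (Λ : BiMap a b a' b') : Prop :=
  ∃ (n m : ℕ) (K : Fin n → Matrix a' a ℂ) (L : Fin n → Fin m → Matrix b' b ℂ),
    IsInstrument k K ∧ (∀ i, IsInstrument .tracePreserving (L i)) ∧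
      Λ = ∑ i, ∑ j, krausMap (K i ⊗ₖ L i j)

/-- One-way LOCC with messages from Bob to Alice only. -/
def IsBobToAlice (k : OpKind) {a b a' b' : Type} [Fintype a] [Fintype b] [Fintype a'] [Fintype b']
    [DecidableEq a] [DecidableEq b] (Λ : BiMap a b a' b') : Prop :=
  ∃ (n m : ℕ) (L : Fin n → Matrix b' b ℂ) (K : Fin n → Fin m → Matrix a' a ℂ),
    IsInstrument k L ∧ (∀ i, IsInstrument .tracePreserving (K i)) ∧
      Λ = ∑ i, ∑ j, krausMap (K i j ⊗ₖ L i)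

/-- Two-way LOCC: finitely many rounds. In each round one party measures her or his system (which
may change its dimension) and announces the outcome `i`, on which the rest `Λ i` of the protocol
depends. In the conclusive case outcomes may be discarded in every round. -/
inductive IsTwoWay (k : OpKind) : {a b a' b' : Type} → BiMap a b a' b' → Prop
  | finish {a b : Type} : IsTwoWay k (LinearMap.id : BiMap a b a b)
  | alice {a a₁ b a' b' : Type} [Fintype a] [DecidableEq a] [Fintype a₁] [Fintype b]
      [DecidableEq b] {n : ℕ} (K : Fin n → Matrix a₁ a ℂ) (hK : IsInstrument k K)
      (Λ : Fin n → BiMap a₁ b a' b') (hΛ : ∀ i, IsTwoWay k (Λ i)) :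
      IsTwoWay k (∑ i, Λ i ∘ₗ krausMap (K i ⊗ₖ (1 : Matrix b b ℂ)))
  | bob {a b b₁ a' b' : Type} [Fintype a] [DecidableEq a] [Fintype b] [DecidableEq b]
      [Fintype b₁] {n : ℕ} (L : Fin n → Matrix b₁ b ℂ) (hL : IsInstrument k L)
      (Λ : Fin n → BiMap a b₁ a' b') (hΛ : ∀ i, IsTwoWay k (Λ i)) :
      IsTwoWay k (∑ i, Λ i ∘ₗ krausMap ((1 : Matrix a a ℂ) ⊗ₖ L i))

/-- The two parties. -/
inductive Party
  | alice
  | bob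

/-- Allowed classical communication: from one given party to the other only, or both ways. -/
inductive Comm
  | oneWayFrom (s : Party)
  | twoWay

/-- `Λ` is an LOCC operation with communication `c` and of kind `k`. -/
def IsLOCC (c : Comm) (k : OpKind) {a b a' b' : Type} [Fintype a] [Fintype b] [Fintype a']
    [Fintype b'] [DecidableEq a] [DecidableEq b] (Λ : BiMap a b a' b') : Prop :=
  match c with
  | .oneWayFrom .alice => IsAliceToBob k Λ
  | .oneWayFrom .bob => IsBobToAlice k Λ
  | .twoWay => IsTwoWay k Λ

/-! ### Optimal singlet fraction -/

/-- The singlet fractions of the normalized outputs that operations of the given class produce from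
`ρ` with nonzero probability. -/
def singletFractions (c : Comm) (k : OpKind) {d : ℕ}
    (ρ : Matrix (Fin d × Fin d) (Fin d × Fin d) ℂ) : Set ℝ :=
  {x | ∃ Λ : BiMap (Fin d) (Fin d) (Fin d) (Fin d), IsLOCC c k Λ ∧
    0 < (Λ ρ).trace.re ∧ x = singletFraction (Λ ρ) / (Λ ρ).trace.re}

/-- The optimal singlet fraction `F_max` under the given class. -/
def optSingletFraction (c : Comm) (k : OpKind) {d : ℕ}
    (ρ : Matrix (Fin d × Fin d) (Fin d × Fin d) ℂ) : ℝ :=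
  sSup (singletFractions c k ρ)

/-! ### Optimal teleportation fidelity -/

/-- The unit vectors of `ℂ^d`. -/
abbrev PureVec (d : ℕ) : Type := Metric.sphere (0 : EuclideanSpace ℂ (Fin d)) 1

/-- The average of `g` over the unit sphere of `ℂ^d` with its uniform probability measure. -/
def avg {d : ℕ} (g : PureVec d → ℝ) : ℝ :=
  ⨍ ψ, g ψ ∂(volume : Measure (EuclideanSpace ℂ (Fin d))).toSphere

/-- A teleportation protocol from `s`. The sender holds an additional input system `ℂ^d` (first
factor of the sender's index) and in the end keeps nothing (index `Unit`); the receiver ends with a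
system `ℂ^d`. -/
def TelMap (d : ℕ) : Party → Type
  | .alice => BiMap (Fin d × Fin d) (Fin d) Unit (Fin d)
  | .bob => BiMap (Fin d) (Fin d × Fin d) (Fin d) Unit

/-- The protocol is an LOCC operation of the given class. -/
def IsTelLOCC (c : Comm) (k : OpKind) {d : ℕ} : (s : Party) → TelMap d s → Prop
  | .alice, T => IsLOCC (a := Fin d × Fin d) (b := Fin d) (a' := Unit) (b' := Fin d) c k T
  | .bob, T => IsLOCC (a := Fin d) (b := Fin d × Fin d) (a' := Fin d) (b' := Unit) c k T

/-- The unnormalized final matrix of the receiver when the sender's input is `ψ` and the parties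
share `ρ`: the protocol is applied to `|ψ⟩⟨ψ| ⊗ ρ`. -/
def telOutput {d : ℕ} (ρ : Matrix (Fin d × Fin d) (Fin d × Fin d) ℂ) (ψ : PureVec d) :
    (s : Party) → TelMap d s → Matrix (Fin d) (Fin d) ℂ
  | .alice, T => Matrix.of fun x y =>
      (show BiMap (Fin d × Fin d) (Fin d) Unit (Fin d) from T)
        (Matrix.of fun p q =>
          ψ.1 p.1.1 * star (ψ.1 q.1.1) * ρ (p.1.2, p.2) (q.1.2, q.2)) ((), x) ((), y)
  | .bob, T => Matrix.of fun x y =>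
      (show BiMap (Fin d) (Fin d × Fin d) (Fin d) Unit from T)
        (Matrix.of fun p q =>
          ψ.1 p.2.1 * star (ψ.1 q.2.1) * ρ (p.1, p.2.2) (q.1, q.2.2)) (x, ()) (y, ())

/-- Probability of success of the protocol for a uniformly random input vector. -/
def telProb {d : ℕ} (ρ : Matrix (Fin d × Fin d) (Fin d × Fin d) ℂ) (s : Party)
    (T : TelMap d s) : ℝ :=
  avg fun ψ => (telOutput ρ ψ s T).trace.re

/-- Fidelity of the protocol: the expectation of `⟨ψ|output|ψ⟩` for a uniformly random input vector
`ψ`, conditional on success. -/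
def telFidelity {d : ℕ} (ρ : Matrix (Fin d × Fin d) (Fin d × Fin d) ℂ) (s : Party)
    (T : TelMap d s) : ℝ :=
  (avg fun ψ => (star (fun i => ψ.1 i) ⬝ᵥ (telOutput ρ ψ s T *ᵥ fun i => ψ.1 i)).re) /
    telProb ρ s T

/-- The fidelities of teleportation from `s` through `ρ` by protocols of the given class that succeed
with nonzero probability. -/
def telFidelities (c : Comm) (k : OpKind) (s : Party) {d : ℕ}
    (ρ : Matrix (Fin d × Fin d) (Fin d × Fin d) ℂ) : Set ℝ :=
  {x | ∃ T : TelMap d s, IsTelLOCC c k s T ∧ 0 < telProb ρ s T ∧ x = telFidelity ρ s T}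

/-- The optimal teleportation fidelity `f_max` from `s` through `ρ` under the given class. -/
def optTelFidelity (c : Comm) (k : OpKind) (s : Party) {d : ℕ}
    (ρ : Matrix (Fin d × Fin d) (Fin d × Fin d) ℂ) : ℝ :=
  sSup (telFidelities c k s ρ)

/-! ### Twirling -/

instance unitaryGroup_compactSpace (d : ℕ) : CompactSpace (Matrix.unitaryGroup (Fin d) ℂ) := by
  refine isCompact_iff_compactSpace.mp ?_
  have hsub : ((Matrix.unitaryGroup (Fin d) ℂ : Submonoid (Matrix (Fin d) (Fin d) ℂ)) :
      Set (Matrix (Fin d) (Fin d) ℂ)) ⊆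
        Set.pi Set.univ fun _ => Set.pi Set.univ fun _ => Metric.closedBall (0 : ℂ) 1 := by
    intro U hU i _ j _
    simpa using entry_norm_bound_of_unitary hU i j
  refine IsCompact.of_isClosed_subset (isCompact_univ_pi fun _ => isCompact_univ_pi fun _ =>
    isCompact_closedBall _ _) ?_ hsub
  have : ((Matrix.unitaryGroup (Fin d) ℂ : Submonoid (Matrix (Fin d) (Fin d) ℂ)) :
      Set (Matrix (Fin d) (Fin d) ℂ)) = {U | star U * U = 1 ∧ U * star U = 1} := by
    ext U; exact Unitary.mem_iff
  rw [this]
  exact (isClosed_eq (by fun_prop) continuous_const).inter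
    (isClosed_eq (by fun_prop) continuous_const)

instance unitaryGroup_measurableSpace (d : ℕ) :
    MeasurableSpace (Matrix.unitaryGroup (Fin d) ℂ) := borel _

instance unitaryGroup_borelSpace (d : ℕ) : BorelSpace (Matrix.unitaryGroup (Fin d) ℂ) := ⟨rfl⟩

/-- The Haar probability measure on the unitary group `U(d)`. -/
def haarU (d : ℕ) : Measure (Matrix.unitaryGroup (Fin d) ℂ) := Measure.haarMeasure ⊤

instance haarU_isFiniteMeasure (d : ℕ) : IsFiniteMeasure (haarU d) := by
  refine ⟨?_⟩
  have h := Measure.haarMeasure_self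
    (K₀ := (⊤ : TopologicalSpace.PositiveCompacts (Matrix.unitaryGroup (Fin d) ℂ)))
  rw [TopologicalSpace.PositiveCompacts.coe_top] at h
  rw [haarU, h]
  exact ENNReal.one_lt_top

/-- The unitary `U ⊗ U*`, where `U*` is the entrywise complex conjugate of `U`. -/
def twirlU {d : ℕ} (U : Matrix.unitaryGroup (Fin d) ℂ) :
    Matrix (Fin d × Fin d) (Fin d × Fin d) ℂ :=
  U.1 ⊗ₖ U.1.map star

lemma twirlU_integrable {d : ℕ} (X : Matrix (Fin d × Fin d) (Fin d × Fin d) ℂ)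
    (p q : Fin d × Fin d) :
    Integrable (fun U => (twirlU U * X * (twirlU U)ᴴ) p q) (haarU d) := by
  have hc : Continuous fun U : Matrix.unitaryGroup (Fin d) ℂ => (twirlU U : Matrix _ _ ℂ) := by
    refine continuous_matrix fun i j => ?_
    have h : ∀ x y : Fin d, Continuous fun U : Matrix.unitaryGroup (Fin d) ℂ => U.1 x y :=
      fun x y => continuous_subtype_val.matrix_elem x y
    exact (h i.1 j.1).mul (continuous_star.comp (h i.2 j.2))
  have hcont : Continuous fun U : Matrix.unitaryGroup (Fin d) ℂ =>
      (twirlU U * X * (twirlU U)ᴴ) p q :=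
    (((hc.matrix_mul continuous_const).matrix_mul hc.matrix_conjTranspose)).matrix_elem p q
  exact hcont.integrable_of_hasCompactSupport (HasCompactSupport.of_compactSpace _)

/-- The twirling operation `X ↦ ∫ (U ⊗ U*) X (U ⊗ U*)ᴴ dU`. -/
def twirl (d : ℕ) : BiMap (Fin d) (Fin d) (Fin d) (Fin d) where
  toFun X := Matrix.of fun p q => ∫ U, (twirlU U * X * (twirlU U)ᴴ) p q ∂haarU d
  map_add' X Y := by
    ext p q
    simp only [Matrix.of_apply, Matrix.add_apply, Matrix.mul_add, Matrix.add_mul]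
    exact integral_add (twirlU_integrable X p q) (twirlU_integrable Y p q)
  map_smul' c X := by
    ext p q
    simp only [Matrix.of_apply, Matrix.smul_apply, Matrix.mul_smul, Matrix.smul_mul,
      RingHom.id_apply]
    exact integral_smul c _

end

/-! Teleportation fidelity. A protocol from Alice is judged through the matrix `telChoi` that arises
when half of a maximally entangled pair of hers is teleported. The second and fourth moments of the
uniform measure on the sphere, the latter being `(δᵢⱼ δₖₗ + δᵢₗ δₖⱼ) / (d (d + 1))` for `ψᵢ ψ̄ⱼ ψₖ
ψ̄ₗ`, turn the success probability into the trace of `telChoi` and the fidelity into `(d F + 1) / (d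
+ 1)`, with `F` its normalized singlet fraction (`telProb_alice`, `telFidelity_alice`). Preparing
the pair is local, so `telChoi` is itself the output of an operation of the same class on `ρ`; this
gives the upper bound in every class. Conversely, the standard protocol with shift and phase
unitaries conserves trace and singlet fraction (`exists_teleportation`) and needs messages from the
sender only. Performed after an operation that yields singlet fraction `F`, it attains `(d F + 1) /
(d + 1)`.

Thresholds. Over `ℂ`, a pencil of two matrices, one of them invertible, has a singular member, so
the range of a strictly mixed state contains a nonzero vector `φ` with singular coefficient matrix
(`exists_det_eq_zero_of_isStrictlyMixed`), and `ρ ≥ r |φ⟩⟨φ|` for some `r > 0`. Every LOCC operation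
is a sum of Kraus maps `A ⊗ B`, which send a coefficient matrix `M` to `A M Bᵀ` and keep it
singular; a singular vector has at least the share `1 / d²` of its weight outside `Ψ₊`. Hence `Λ ρ`
loses at least `r / d²` times the trace of `Λ |φ⟩⟨φ|`, and what remains is to compare this trace
with that of `Λ ρ`. - Trace-preserving operations: both traces are known. - Full rank: product basis
vectors take the place of `φ`, and their projections sum to `1 ≥ ρ`. - One-way from Alice: for each
outcome, Bob's channel leaves Alice's reduced matrix alone. Either this matrix is small in some
direction, which already keeps the output away from `Ψ₊`, or her Kraus operator is bounded below,
and then `φ` passes with a comparable probability.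

Twirling. A Haar mean of a continuous function into a finite-dimensional space is a finite convex
combination of values, so the twirling is a finite random choice of local unitaries, drawn and
announced by either party.

Statements for Bob follow from those for Alice by exchange of the tensor factors. -/

noncomputable section

/-! ### Measurements -/

/-- The condition that an operation of kind `k` imposes on `∑ Kᵢᴴ Kᵢ`. -/
def Admissible (k : OpKind) {p : Type} [DecidableEq p] (S : Matrix p p ℂ) : Prop :=
  match k with
  | .tracePreserving => S = 1
  | .conclusive => (1 - S).PosSemidef

lemma isInstrument_iff {p q : Type} [Fintype q] [DecidableEq p] {k : OpKind} {n : ℕ}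
    {K : Fin n → Matrix q p ℂ} : IsInstrument k K ↔ Admissible k (∑ i, (K i)ᴴ * K i) := by
  cases k <;> rfl

lemma admissible_one (k : OpKind) {p : Type} [DecidableEq p] :
    Admissible k (1 : Matrix p p ℂ) := by
  cases k
  · rfl
  · simpa [Admissible] using Matrix.PosSemidef.zero

lemma isInstrument_of_tracePreserving {p q : Type} [Fintype q] [DecidableEq p] (k : OpKind) {n : ℕ}
    {K : Fin n → Matrix q p ℂ} (h : IsInstrument .tracePreserving K) : IsInstrument k K := by
  have h' : ∑ i, (K i)ᴴ * K i = 1 := h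
  rw [isInstrument_iff, h']
  exact admissible_one k

/-- The defect `1 - ∑ Kᴴ G K` splits into the part discarded in the first measurement and the parts
`Kᴴ (1 - G) K` discarded afterwards. -/
lemma Admissible.refine {k : OpKind} {p q ι : Type} [Fintype ι] [Finite p] [Fintype q]
    [DecidableEq p] [DecidableEq q] {K : ι → Matrix q p ℂ} {G : ι → Matrix q q ℂ}
    (hK : Admissible k (∑ i, (K i)ᴴ * K i)) (hG : ∀ i, Admissible k (G i)) :
    Admissible k (∑ i, (K i)ᴴ * G i * K i) := by
  cases k
  · have hG' : ∀ i, G i = 1 := hG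
    simpa [hG'] using hK
  · have e : 1 - ∑ i, (K i)ᴴ * G i * K i =
        (1 - ∑ i, (K i)ᴴ * K i) + ∑ i, (K i)ᴴ * (1 - G i) * K i := by
      simp [Matrix.mul_sub, Matrix.sub_mul]
    change (1 - ∑ i, (K i)ᴴ * G i * K i).PosSemidef
    rw [e]
    exact Matrix.PosSemidef.add hK (Matrix.posSemidef_sum _ fun i _ =>
      Matrix.PosSemidef.conjTranspose_mul_mul_same (hG i) (K i))

lemma Admissible.gram_comp {k : OpKind} {p q r ι κ : Type} [Fintype ι] [Fintype κ] [Finite p]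
    [Fintype q] [Fintype r] [DecidableEq p] [DecidableEq q] {K : ι → Matrix q p ℂ}
    {K' : ι → κ → Matrix r q ℂ} (hK : Admissible k (∑ i, (K i)ᴴ * K i))
    (hK' : ∀ i, Admissible k (∑ j, (K' i j)ᴴ * K' i j)) :
    Admissible k (∑ x : ι × κ, (K' x.1 x.2 * K x.1)ᴴ * (K' x.1 x.2 * K x.1)) := by
  have h := hK.refine hK'
  convert h using 1
  rw [Fintype.sum_prod_type]
  refine Finset.sum_congr rfl fun i _ => ?_
  simp only [Matrix.mul_sum, Matrix.sum_mul]
  refine Finset.sum_congr rfl fun j _ => ?_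
  simp only [Matrix.conjTranspose_mul, Matrix.mul_assoc]

/-! ### Kraus maps -/

@[simp] lemma krausMap_apply {p q : Type} [Fintype p] (K : Matrix q p ℂ) (X : Matrix p p ℂ) :
    krausMap K X = K * X * Kᴴ := rfl

lemma krausMap_comp {p q r : Type} [Fintype p] [Fintype q] (K' : Matrix r q ℂ)
    (K : Matrix q p ℂ) : krausMap K' ∘ₗ krausMap K = krausMap (K' * K) := by
  ext1 X
  simp [Matrix.mul_assoc]

lemma krausMap_one {p : Type} [Fintype p] [DecidableEq p] :
    krausMap (1 : Matrix p p ℂ) = LinearMap.id := by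
  ext1 X
  simp

lemma sum_comp_sum {R M N P ι κ : Type*} [CommRing R] [AddCommGroup M] [AddCommGroup N]
    [AddCommGroup P] [Module R M] [Module R N] [Module R P] [Fintype ι] [Fintype κ]
    (f : ι → N →ₗ[R] P) (g : κ → M →ₗ[R] N) :
    (∑ i, f i) ∘ₗ (∑ j, g j) = ∑ j, ∑ i, f i ∘ₗ g j := by
  ext x
  simp only [LinearMap.comp_apply, LinearMap.sum_apply, map_sum]

/-! ### Operations from Alice to Bob -/

lemma isAliceToBob_of_fintype {k : OpKind} {a b a' b' ι κ : Type} [Fintype a] [Fintype b]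
    [Fintype a'] [Fintype b'] [DecidableEq a] [DecidableEq b] [Fintype ι] [Fintype κ]
    (K : ι → Matrix a' a ℂ) (L : ι → κ → Matrix b' b ℂ)
    (hK : Admissible k (∑ i, (K i)ᴴ * K i)) (hL : ∀ i, ∑ j, (L i j)ᴴ * L i j = 1) :
    IsAliceToBob k (∑ i, ∑ j, krausMap (K i ⊗ₖ L i j)) := by
  let e := (Fintype.equivFin ι).symm
  let e' := (Fintype.equivFin κ).symm
  refine ⟨_, _, fun i => K (e i), fun i j => L (e i) (e' j), ?_, fun i => ?_, ?_⟩
  · rw [isInstrument_iff, e.sum_comp fun i => (K i)ᴴ * K i]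
    exact hK
  · change ∑ j, (L (e i) (e' j))ᴴ * L (e i) (e' j) = 1
    rw [e'.sum_comp fun j => (L (e i) j)ᴴ * L (e i) j]
    exact hL _
  · rw [← e.sum_comp]
    refine Finset.sum_congr rfl fun i _ => ?_
    rw [← e'.sum_comp]

/-- Alice can do both measurements before Bob acts, since nothing that she does depends on him; the
pair of outcomes is one message, and Bob composes his two channels. -/
lemma IsAliceToBob.comp {k : OpKind} {a b a' b' a'' b'' : Type} [Fintype a] [Fintype b]
    [Fintype a'] [Fintype b'] [Fintype a''] [Fintype b''] [DecidableEq a] [DecidableEq b]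
    [DecidableEq a'] [DecidableEq b'] {Γ : BiMap a' b' a'' b''} {Λ : BiMap a b a' b'}
    (hΓ : IsAliceToBob k Γ) (hΛ : IsAliceToBob k Λ) : IsAliceToBob k (Γ ∘ₗ Λ) := by
  obtain ⟨n, m, K, L, hK, hL, rfl⟩ := hΛ
  obtain ⟨n', m', K', L', hK', hL', rfl⟩ := hΓ
  have hK₂ : Admissible k (∑ x : Fin n × Fin n', (K' x.2 * K x.1)ᴴ * (K' x.2 * K x.1)) :=
    Admissible.gram_comp (K' := fun _ => K') (isInstrument_iff.1 hK)
      fun _ => isInstrument_iff.1 hK'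
  have hL₂ : ∀ x : Fin n × Fin n', ∑ y : Fin m × Fin m',
      (L' x.2 y.2 * L x.1 y.1)ᴴ * (L' x.2 y.2 * L x.1 y.1) = 1 := fun x =>
    Admissible.gram_comp (k := .tracePreserving) (K' := fun _ => L' x.2)
      (isInstrument_iff.1 (hL x.1)) fun _ => isInstrument_iff.1 (hL' x.2)
  have e : (∑ i, ∑ j, krausMap (K' i ⊗ₖ L' i j)) ∘ₗ (∑ i, ∑ j, krausMap (K i ⊗ₖ L i j)) =
      ∑ x : Fin n × Fin n', ∑ y : Fin m × Fin m',
        krausMap ((K' x.2 * K x.1) ⊗ₖ (L' x.2 y.2 * L x.1 y.1)) := by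
    rw [sum_comp_sum, Fintype.sum_prod_type]
    refine Finset.sum_congr rfl fun i _ => Finset.sum_congr rfl fun s _ => ?_
    rw [sum_comp_sum, Fintype.sum_prod_type]
    refine Finset.sum_congr rfl fun j _ => Finset.sum_congr rfl fun t _ => ?_
    rw [krausMap_comp, Matrix.mul_kronecker_mul]
  rw [e]
  exact isAliceToBob_of_fintype (fun x : Fin n × Fin n' => K' x.2 * K x.1)
    (fun x (y : Fin m × Fin m') => L' x.2 y.2 * L x.1 y.1) hK₂ hL₂

/-! ### Two-way operations -/

lemma IsTwoWay.comp {k : OpKind} {a b a' b' a'' b'' : Type} {Γ : BiMap a' b' a'' b''}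
    {Λ : BiMap a b a' b'} (hΓ : IsTwoWay k Γ) (hΛ : IsTwoWay k Λ) : IsTwoWay k (Γ ∘ₗ Λ) := by
  induction hΛ with
  | finish => exact hΓ
  | alice K hK Λ _ ih =>
    have h := IsTwoWay.alice K hK (fun i => Γ ∘ₗ Λ i) fun i => ih i hΓ
    convert h using 1
    ext1 X
    simp only [LinearMap.comp_apply, LinearMap.sum_apply, map_sum]
  | bob L hL Λ _ ih =>
    have h := IsTwoWay.bob L hL (fun i => Γ ∘ₗ Λ i) fun i => ih i hΓ
    convert h using 1
    ext1 X
    simp only [LinearMap.comp_apply, LinearMap.sum_apply, map_sum]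

lemma IsAliceToBob.isTwoWay {k : OpKind} {a b a' b' : Type} [Fintype a] [Fintype b]
    [Fintype a'] [Fintype b'] [DecidableEq a] [DecidableEq b] {Λ : BiMap a b a' b'}
    (hΛ : IsAliceToBob k Λ) : IsTwoWay k Λ := by
  classical
  obtain ⟨n, m, K, L, hK, hL, rfl⟩ := hΛ
  have h := IsTwoWay.alice K hK _ fun i => IsTwoWay.bob (k := k) (a := a') (L i)
    (isInstrument_of_tracePreserving k (hL i)) (fun _ => LinearMap.id) fun _ => IsTwoWay.finish
  convert h using 1
  refine Finset.sum_congr rfl fun i _ => ?_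
  ext1 X
  simp only [LinearMap.id_comp, LinearMap.comp_apply, LinearMap.sum_apply]
  refine Finset.sum_congr rfl fun j _ => ?_
  rw [← LinearMap.comp_apply, krausMap_comp, ← Matrix.mul_kronecker_mul, Matrix.one_mul,
    Matrix.mul_one]

/-! ### Exchange of the parties -/

/-- Exchange of the tensor factors of a matrix on a joint system. -/
def swapMat (a b : Type) : Matrix (a × b) (a × b) ℂ →ₗ[ℂ] Matrix (b × a) (b × a) ℂ :=
  (Matrix.reindexLinearEquiv ℂ ℂ (Equiv.prodComm a b) (Equiv.prodComm a b)).toLinearMap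

@[simp] lemma swapMat_apply {a b : Type} (X : Matrix (a × b) (a × b) ℂ) (p q : b × a) :
    swapMat a b X p q = X p.swap q.swap := rfl

@[simp] lemma swapMat_swapMat {a b : Type} (X : Matrix (a × b) (a × b) ℂ) :
    swapMat b a (swapMat a b X) = X := rfl

/-- An operation with the roles of the parties exchanged. -/
def swapMap {a b a' b' : Type} (Λ : BiMap a b a' b') : BiMap b a b' a' :=
  swapMat a' b' ∘ₗ Λ ∘ₗ swapMat b a

@[simp] lemma swapMap_swapMap {a b a' b' : Type} (Λ : BiMap a b a' b') :
    swapMap (swapMap Λ) = Λ := by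
  ext X p q
  rfl

lemma swapMap_apply {a b a' b' : Type} (Λ : BiMap a b a' b') (X : Matrix (b × a) (b × a) ℂ) :
    swapMap Λ X = swapMat a' b' (Λ (swapMat b a X)) := rfl

lemma swapMap_comp {a b a' b' a'' b'' : Type} (Γ : BiMap a' b' a'' b'') (Λ : BiMap a b a' b') :
    swapMap (Γ ∘ₗ Λ) = swapMap Γ ∘ₗ swapMap Λ := by
  ext X p q
  rfl

lemma swapMap_sum {a b a' b' ι : Type} [Fintype ι] (Λ : ι → BiMap a b a' b') :
    swapMap (∑ i, Λ i) = ∑ i, swapMap (Λ i) := by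
  ext1 X
  simp [swapMap_apply]

lemma swapMap_krausMap {a b a' b' : Type} [Fintype a] [Fintype b] (A : Matrix a' a ℂ)
    (B : Matrix b' b ℂ) : swapMap (krausMap (A ⊗ₖ B)) = krausMap (B ⊗ₖ A) := by
  ext X p q
  simp only [swapMap_apply, swapMat_apply, krausMap_apply, Matrix.mul_apply, Finset.sum_mul,
    Matrix.conjTranspose_apply]
  rw [← (Equiv.prodComm a b).sum_comp]
  refine Finset.sum_congr rfl fun r _ => ?_
  rw [← (Equiv.prodComm a b).sum_comp]
  refine Finset.sum_congr rfl fun s _ => ?_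
  simp [mul_comm]

lemma IsTwoWay.swapMap {k : OpKind} {a b a' b' : Type} {Λ : BiMap a b a' b'}
    (hΛ : IsTwoWay k Λ) : IsTwoWay k (swapMap Λ) := by
  induction hΛ with
  | finish =>
    convert IsTwoWay.finish using 1
    ext X p q
    rfl
  | alice K hK Λ _ ih =>
    have h := IsTwoWay.bob K hK _ ih
    convert h using 1
    simp only [swapMap_sum, swapMap_comp, swapMap_krausMap]
  | bob L hL Λ _ ih =>
    have h := IsTwoWay.alice L hL _ ih
    convert h using 1
    simp only [swapMap_sum, swapMap_comp, swapMap_krausMap]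

/-- The other party. -/
def Party.swap : Party → Party
  | .alice => .bob
  | .bob => .alice

/-- The communication with the roles of the parties exchanged. -/
def Comm.swap : Comm → Comm
  | .oneWayFrom s => .oneWayFrom s.swap
  | .twoWay => .twoWay

@[simp] lemma Comm.swap_swap (c : Comm) : c.swap.swap = c := by
  rcases c with (_ | _) | _ <;> rfl

lemma IsLOCC.swapMap {c : Comm} {k : OpKind} {a b a' b' : Type} [Fintype a] [Fintype b]
    [Fintype a'] [Fintype b'] [DecidableEq a] [DecidableEq b] {Λ : BiMap a b a' b'}
    (hΛ : IsLOCC c k Λ) : IsLOCC c.swap k (swapMap Λ) := by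
  rcases c with (_ | _) | _
  · obtain ⟨n, m, K, L, hK, hL, rfl⟩ := hΛ
    refine ⟨n, m, K, L, hK, hL, ?_⟩
    simp only [swapMap_sum, swapMap_krausMap]
  · obtain ⟨n, m, K, L, hK, hL, rfl⟩ := hΛ
    refine ⟨n, m, K, L, hK, hL, ?_⟩
    simp only [swapMap_sum, swapMap_krausMap]
  · exact IsTwoWay.swapMap hΛ

lemma isLOCC_swap_iff {c : Comm} {k : OpKind} {a b a' b' : Type} [Fintype a] [Fintype b]
    [Fintype a'] [Fintype b'] [DecidableEq a] [DecidableEq b] {Λ : BiMap a b a' b'} :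
    IsLOCC c.swap k (swapMap Λ) ↔ IsLOCC c k Λ :=
  ⟨fun h => by simpa using h.swapMap, fun h => h.swapMap⟩

/-! ### Closure properties of all classes -/

lemma IsLOCC.comp {c : Comm} {k : OpKind} {a b a' b' a'' b'' : Type} [Fintype a] [Fintype b]
    [Fintype a'] [Fintype b'] [Fintype a''] [Fintype b''] [DecidableEq a] [DecidableEq b]
    [DecidableEq a'] [DecidableEq b'] {Γ : BiMap a' b' a'' b''} {Λ : BiMap a b a' b'}
    (hΓ : IsLOCC c k Γ) (hΛ : IsLOCC c k Λ) : IsLOCC c k (Γ ∘ₗ Λ) := by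
  rcases c with (_ | _) | _
  · exact IsAliceToBob.comp hΓ hΛ
  · rw [← isLOCC_swap_iff, swapMap_comp]
    exact IsAliceToBob.comp hΓ.swapMap hΛ.swapMap
  · exact IsTwoWay.comp hΓ hΛ

lemma IsLOCC.of_isAliceToBob {c : Comm} {k : OpKind} (hc : c = .twoWay ∨ c = .oneWayFrom .alice)
    {a b a' b' : Type} [Fintype a] [Fintype b] [Fintype a'] [Fintype b'] [DecidableEq a]
    [DecidableEq b] {Λ : BiMap a b a' b'} (hΛ : IsAliceToBob k Λ) : IsLOCC c k Λ := by
  rcases hc with rfl | rfl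
  · exact hΛ.isTwoWay
  · exact hΛ

/-- A complete measurement by Alice whose outcome is forgotten belongs to every class. -/
lemma isLOCC_local {c : Comm} {k : OpKind} {a b a' ι : Type} [Fintype a] [Fintype b] [Fintype a']
    [DecidableEq a] [DecidableEq b] [Fintype ι] (K : ι → Matrix a' a ℂ)
    (hK : ∑ i, (K i)ᴴ * K i = 1) :
    IsLOCC c k (∑ i, krausMap (K i ⊗ₖ (1 : Matrix b b ℂ))) := by
  have hA : IsAliceToBob k (∑ i, krausMap (K i ⊗ₖ (1 : Matrix b b ℂ))) := by
    have h := isAliceToBob_of_fintype (k := k) K (fun _ (_ : Unit) => (1 : Matrix b b ℂ))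
      (by rw [hK]; exact admissible_one k) (by simp)
    simpa using h
  rcases c with (_ | _) | _
  · exact hA
  -- Here Bob speaks: he sends a trivial message, and Alice's measurement serves as the receiver's
  -- channel, which is why it must be complete.
  · rw [← isLOCC_swap_iff]
    have h := isAliceToBob_of_fintype (k := k) (fun _ : Unit => (1 : Matrix b b ℂ))
      (fun _ => K) (by simpa using admissible_one k) (fun _ => hK)
    simp only [Finset.univ_unique, Finset.sum_singleton] at h
    simp only [swapMap_sum, swapMap_krausMap]
    exact h
  · exact hA.isTwoWay

lemma isLOCC_isometry {c : Comm} {k : OpKind} {a b a' : Type} [Fintype a] [Fintype b] [Fintype a']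
    [DecidableEq a] [DecidableEq b] (V : Matrix a' a ℂ) (hV : Vᴴ * V = 1) :
    IsLOCC c k (krausMap (V ⊗ₖ (1 : Matrix b b ℂ))) := by
  simpa using isLOCC_local (c := c) (k := k) (b := b) (fun _ : Unit => V) (by simpa using hV)

/-! ### An ancilla on Alice's side -/

/-- The operation `Λ` in the presence of an ancilla `e` of Alice on which nothing is done. -/
def ampMap (e : Type) {a b a' b' : Type} (Λ : BiMap a b a' b') :
    BiMap (e × a) b (e × a') b' where
  toFun X := Matrix.of fun p q =>
    Λ (X.submatrix (fun r => ((p.1.1, r.1), r.2)) fun s => ((q.1.1, s.1), s.2))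
      (p.1.2, p.2) (q.1.2, q.2)
  map_add' X Y := by
    ext p q
    simp [Matrix.submatrix_add]
  map_smul' c X := by
    ext p q
    simp [Matrix.submatrix_smul]

lemma ampMap_apply {e a b a' b' : Type} (Λ : BiMap a b a' b')
    (X : Matrix ((e × a) × b) ((e × a) × b) ℂ) (p q : (e × a') × b') :
    ampMap e Λ X p q =
      Λ (X.submatrix (fun r => ((p.1.1, r.1), r.2)) fun s => ((q.1.1, s.1), s.2))
        (p.1.2, p.2) (q.1.2, q.2) := rfl

lemma ampMap_sum {e a b a' b' ι : Type} [Fintype ι] (Λ : ι → BiMap a b a' b') :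
    ampMap e (∑ i, Λ i) = ∑ i, ampMap e (Λ i) := by
  ext X p q
  simp only [ampMap_apply, LinearMap.sum_apply, Matrix.sum_apply]

lemma ampMap_comp {e a b a' b' a'' b'' : Type} (Γ : BiMap a' b' a'' b'') (Λ : BiMap a b a' b') :
    ampMap e (Γ ∘ₗ Λ) = ampMap e Γ ∘ₗ ampMap e Λ := by
  ext X p q
  rfl

lemma ampMap_krausMap {e a b a' b' : Type} [Fintype e] [DecidableEq e] [Fintype a] [Fintype b]
    (A : Matrix a' a ℂ) (B : Matrix b' b ℂ) :
    ampMap e (krausMap (A ⊗ₖ B)) = krausMap (((1 : Matrix e e ℂ) ⊗ₖ A) ⊗ₖ B) := by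
  ext X p q
  simp only [ampMap_apply, krausMap_apply, Matrix.mul_apply, Matrix.conjTranspose_apply,
    Matrix.kroneckerMap_apply, Fintype.sum_prod_type, Matrix.one_apply, Matrix.submatrix_apply]
  simp [Finset.sum_ite_irrel, apply_ite (starRingEnd ℂ)]

lemma one_kronecker_gram {e p q : Type} [Fintype e] [DecidableEq e] [Fintype q]
    (K : Matrix q p ℂ) :
    ((1 : Matrix e e ℂ) ⊗ₖ K)ᴴ * ((1 : Matrix e e ℂ) ⊗ₖ K) = (1 : Matrix e e ℂ) ⊗ₖ (Kᴴ * K) := by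
  rw [Matrix.conjTranspose_kronecker, ← Matrix.mul_kronecker_mul, Matrix.conjTranspose_one,
    Matrix.one_mul]

lemma Admissible.one_kronecker {k : OpKind} {e p : Type} [Fintype e] [DecidableEq e] [Fintype p]
    [DecidableEq p] {S : Matrix p p ℂ} (hS : Admissible k S) :
    Admissible k ((1 : Matrix e e ℂ) ⊗ₖ S) := by
  cases k
  · have hS' : S = 1 := hS
    simp [Admissible, hS']
  · have e1 : (1 : Matrix (e × p) (e × p) ℂ) - (1 : Matrix e e ℂ) ⊗ₖ S =
        (1 : Matrix e e ℂ) ⊗ₖ (1 - S) := by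
      rw [sub_eq_add_neg 1 S, Matrix.kronecker_add, Matrix.one_kronecker_one, sub_eq_add_neg]
      congr 1
      ext p q
      simp
    change (_ - _ : Matrix _ _ ℂ).PosSemidef
    rw [e1]
    exact Matrix.PosSemidef.one.kronecker hS

lemma sum_one_kronecker_gram {e p q ι : Type} [Fintype e] [DecidableEq e] [Fintype q] [Fintype ι]
    (K : ι → Matrix q p ℂ) :
    ∑ i, ((1 : Matrix e e ℂ) ⊗ₖ K i)ᴴ * ((1 : Matrix e e ℂ) ⊗ₖ K i) =
      (1 : Matrix e e ℂ) ⊗ₖ ∑ i, (K i)ᴴ * K i := by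
  simp only [one_kronecker_gram]
  ext p q
  simp only [Matrix.sum_apply, Matrix.kroneckerMap_apply, Finset.mul_sum]

lemma IsInstrument.one_kronecker {k : OpKind} {e p q : Type} [Fintype e] [DecidableEq e]
    [Fintype p] [DecidableEq p] [Fintype q] {n : ℕ} {K : Fin n → Matrix q p ℂ}
    (hK : IsInstrument k K) : IsInstrument k fun i => (1 : Matrix e e ℂ) ⊗ₖ K i := by
  rw [isInstrument_iff, sum_one_kronecker_gram]
  exact (isInstrument_iff.1 hK).one_kronecker

lemma IsLOCC.ampMap {c : Comm} {k : OpKind} {e a b a' b' : Type} [Fintype e] [DecidableEq e]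
    [Fintype a] [Fintype b] [Fintype a'] [Fintype b'] [DecidableEq a] [DecidableEq b]
    {Λ : BiMap a b a' b'} (hΛ : IsLOCC c k Λ) : IsLOCC c k (ampMap e Λ) := by
  rcases c with (_ | _) | _
  · obtain ⟨n, m, K, L, hK, hL, rfl⟩ := hΛ
    refine ⟨n, m, fun i => (1 : Matrix e e ℂ) ⊗ₖ K i, L, hK.one_kronecker, hL, ?_⟩
    simp only [ampMap_sum, ampMap_krausMap]
  · obtain ⟨n, m, L, K, hL, hK, rfl⟩ := hΛ
    refine ⟨n, m, L, fun i j => (1 : Matrix e e ℂ) ⊗ₖ K i j, hL, fun i => (hK i).one_kronecker, ?_⟩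
    simp only [ampMap_sum, ampMap_krausMap]
  · have h2 : IsTwoWay k Λ := hΛ
    change IsTwoWay k _
    clear hΛ
    -- The index types vary along the induction; the instances on them, which the goal does not
    -- involve, have to be gone first.
    rename_i f1 f2 f3 f4 f5 f6
    clear f1 f2 f3 f4 f5 f6
    induction h2 with
    | finish => exact IsTwoWay.finish
    | alice K hK Λ _ ih =>
      have h := IsTwoWay.alice (fun i => (1 : Matrix e e ℂ) ⊗ₖ K i) hK.one_kronecker _ ih
      convert h using 1
      simp only [ampMap_sum, ampMap_comp, ampMap_krausMap]
    | bob L hL Λ _ ih =>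
      have h := IsTwoWay.bob L hL _ ih
      convert h using 1
      simp only [ampMap_sum, ampMap_comp, ampMap_krausMap, Matrix.one_kronecker_one]

/-! ### Separable operations -/

/-- A finite sum of Kraus maps with product Kraus operators. -/
def IsSeparableMap {a b a' b' : Type} [Fintype a] [Fintype b] (Λ : BiMap a b a' b') : Prop :=
  ∃ (n : ℕ) (A : Fin n → Matrix a' a ℂ) (B : Fin n → Matrix b' b ℂ),
    Λ = ∑ i, krausMap (A i ⊗ₖ B i)

lemma isSeparableMap_of_fintype {a b a' b' ι : Type} [Fintype a] [Fintype b] [Fintype ι]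
    (A : ι → Matrix a' a ℂ) (B : ι → Matrix b' b ℂ) :
    IsSeparableMap (∑ i, krausMap (A i ⊗ₖ B i)) :=
  ⟨_, _, _, ((Fintype.equivFin ι).symm.sum_comp _).symm⟩

lemma IsSeparableMap.sum {a b a' b' ι : Type} [Fintype a] [Fintype b] [Fintype ι]
    {Λ : ι → BiMap a b a' b'} (h : ∀ i, IsSeparableMap (Λ i)) : IsSeparableMap (∑ i, Λ i) := by
  choose n A B h using h
  have := isSeparableMap_of_fintype (fun x : Σ i, Fin (n i) => A x.1 x.2) fun x => B x.1 x.2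
  rw [Fintype.sum_sigma] at this
  simpa only [← h] using this

lemma IsSeparableMap.comp_krausMap {a b a₁ b₁ a' b' : Type} [Fintype a] [Fintype b] [Fintype a₁]
    [Fintype b₁] {Λ : BiMap a₁ b₁ a' b'} (h : IsSeparableMap Λ) (A : Matrix a₁ a ℂ)
    (B : Matrix b₁ b ℂ) : IsSeparableMap (Λ ∘ₗ krausMap (A ⊗ₖ B)) := by
  obtain ⟨n, A', B', rfl⟩ := h
  refine ⟨n, fun i => A' i * A, fun i => B' i * B, ?_⟩
  ext1 X
  simp only [LinearMap.comp_apply, LinearMap.sum_apply]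
  refine Finset.sum_congr rfl fun i _ => ?_
  rw [← LinearMap.comp_apply, krausMap_comp, Matrix.mul_kronecker_mul]

/-- All that the threshold arguments use of the two-way structure, apart from conservation of the
trace. The instances are quantified after the derivation because they change from round to round;
`Subsingleton.elim` identifies them with those stored in the constructors. -/
lemma IsTwoWay.isSeparableMap {k : OpKind} {a b a' b' : Type} {Λ : BiMap a b a' b'}
    (hΛ : IsTwoWay k Λ) : ∀ [Fintype a] [Fintype b], IsSeparableMap Λ := by
  classical
  induction hΛ with
  | @finish a b =>
    intro _ _
    have h := isSeparableMap_of_fintype (fun _ : Unit => (1 : Matrix a a ℂ))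
      fun _ : Unit => (1 : Matrix b b ℂ)
    simpa [krausMap_one] using h
  | @alice a a₁ b a' b' ia _ _ ib _ n K hK Λ _ ih =>
    intro ia' ib'
    obtain rfl := Subsingleton.elim ia ia'
    obtain rfl := Subsingleton.elim ib ib'
    exact IsSeparableMap.sum fun i => (ih i).comp_krausMap _ _
  | @bob a b b₁ a' b' ia _ ib _ _ n L hL Λ _ ih =>
    intro ia' ib'
    obtain rfl := Subsingleton.elim ia ia'
    obtain rfl := Subsingleton.elim ib ib'
    exact IsSeparableMap.sum fun i => (ih i).comp_krausMap _ _

lemma IsLOCC.isSeparableMap {c : Comm} {k : OpKind} {a b a' b' : Type} [Fintype a] [Fintype b]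
    [Fintype a'] [Fintype b'] [DecidableEq a] [DecidableEq b] {Λ : BiMap a b a' b'}
    (hΛ : IsLOCC c k Λ) : IsSeparableMap Λ := by
  rcases c with (_ | _) | _
  · obtain ⟨n, m, K, L, -, -, rfl⟩ := hΛ
    exact IsSeparableMap.sum fun i => isSeparableMap_of_fintype (fun _ => K i) _
  · obtain ⟨n, m, L, K, -, -, rfl⟩ := hΛ
    exact IsSeparableMap.sum fun i => isSeparableMap_of_fintype _ fun _ => L i
  · exact IsTwoWay.isSeparableMap hΛ

lemma trace_sum_krausMap {p q ι : Type} [Fintype p] [Fintype q] [Fintype ι] (K : ι → Matrix q p ℂ)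
    (X : Matrix p p ℂ) :
    (∑ i, krausMap (K i) X).trace = ((∑ i, (K i)ᴴ * K i) * X).trace := by
  simp only [krausMap_apply, Matrix.trace_sum, Finset.sum_mul]
  refine Finset.sum_congr rfl fun i _ => ?_
  rw [Matrix.trace_mul_comm, Matrix.mul_assoc]

lemma sum_kronecker_one_gram {e p q ι : Type} [Fintype e] [DecidableEq e] [Fintype q] [Fintype ι]
    (K : ι → Matrix q p ℂ) :
    ∑ i, (K i ⊗ₖ (1 : Matrix e e ℂ))ᴴ * (K i ⊗ₖ (1 : Matrix e e ℂ)) =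
      (∑ i, (K i)ᴴ * K i) ⊗ₖ (1 : Matrix e e ℂ) := by
  ext p q
  simp only [Matrix.conjTranspose_kronecker, ← Matrix.mul_kronecker_mul, Matrix.conjTranspose_one,
    Matrix.one_mul, Matrix.sum_apply, Matrix.kroneckerMap_apply, Finset.sum_mul]

lemma IsTwoWay.trace_eq {a b a' b' : Type} {Λ : BiMap a b a' b'}
    (hΛ : IsTwoWay .tracePreserving Λ) : ∀ [Fintype a] [Fintype b] [Fintype a'] [Fintype b']
      (X : Matrix (a × b) (a × b) ℂ), (Λ X).trace = X.trace := by
  classical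
  generalize hk : OpKind.tracePreserving = k at hΛ
  induction hΛ with
  | finish =>
    intro ia ib ia' ib' X
    obtain rfl := Subsingleton.elim ia ia'
    obtain rfl := Subsingleton.elim ib ib'
    rfl
  | @alice a a₁ b a' b' ia _ _ ib _ n K hK Λ _ ih =>
    intro ia' ib' _ _ X
    obtain rfl := Subsingleton.elim ia ia'
    obtain rfl := Subsingleton.elim ib ib'
    subst hk
    have hK' : ∑ i, (K i)ᴴ * K i = 1 := hK
    simp only [LinearMap.sum_apply, LinearMap.comp_apply, Matrix.trace_sum, ih]
    rw [← Matrix.trace_sum, trace_sum_krausMap, sum_kronecker_one_gram, hK',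
      Matrix.one_kronecker_one, Matrix.one_mul]
  | @bob a b b₁ a' b' ia _ ib _ _ n L hL Λ _ ih =>
    intro ia' ib' _ _ X
    obtain rfl := Subsingleton.elim ia ia'
    obtain rfl := Subsingleton.elim ib ib'
    subst hk
    have hL' : ∑ i, (L i)ᴴ * L i = 1 := hL
    simp only [LinearMap.sum_apply, LinearMap.comp_apply, Matrix.trace_sum, ih]
    rw [← Matrix.trace_sum, trace_sum_krausMap, sum_one_kronecker_gram, hL',
      Matrix.one_kronecker_one, Matrix.one_mul]

lemma trace_swapMat {a b : Type} [Fintype a] [Fintype b] (X : Matrix (a × b) (a × b) ℂ) :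
    (swapMat a b X).trace = X.trace :=
  (Equiv.prodComm b a).sum_comp fun p => X p p

lemma IsLOCC.trace_eq {c : Comm} {a b a' b' : Type} [Fintype a] [Fintype b]
    [Fintype a'] [Fintype b'] [DecidableEq a] [DecidableEq b] {Λ : BiMap a b a' b'}
    (hΛ : IsLOCC c .tracePreserving Λ) (X : Matrix (a × b) (a × b) ℂ) :
    (Λ X).trace = X.trace := by
  rcases c with (_ | _) | _
  · exact (IsAliceToBob.isTwoWay hΛ).trace_eq X
  · have h := (IsAliceToBob.isTwoWay hΛ.swapMap).trace_eq (swapMat a b X)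
    simpa [swapMap_apply, trace_swapMat] using h
  · exact IsTwoWay.trace_eq hΛ X

/-! ### Moments of the uniform measure on the sphere -/

open scoped Pointwise in
-- The measure of a set on the sphere is, up to a constant factor, the volume of the cone over it in
-- the unit ball; a linear isometry carries cones to cones and keeps volume.
lemma map_toSphere_linearIsometryEquiv {E : Type*} [NormedAddCommGroup E] [InnerProductSpace ℝ E]
    [FiniteDimensional ℝ E] [MeasurableSpace E] [BorelSpace E] (e : E ≃ₗᵢ[ℝ] E)
    {φ : Metric.sphere (0 : E) 1 → Metric.sphere (0 : E) 1} (hφ : ∀ x, (φ x : E) = e x) :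
    (volume : Measure E).toSphere.map φ = (volume : Measure E).toSphere := by
  have hc : Continuous φ := by
    refine Continuous.subtype_mk (f := fun x => (φ x : E)) ?_ _
    simp only [hφ]
    exact e.continuous.comp continuous_subtype_val
  ext s hs
  rw [Measure.map_apply hc.measurable hs, Measure.toSphere_apply' _ (hc.measurable hs),
    Measure.toSphere_apply' _ hs,
    ← e.measurePreserving.measure_preimage_emb e.toHomeomorph.measurableEmbedding
      (Set.Ioo (0 : ℝ) 1 • (Subtype.val '' s))]
  congr 2
  ext x
  simp only [Set.mem_smul, Set.mem_image, Set.mem_preimage]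
  constructor
  · rintro ⟨r, hr, _, ⟨y, hy, rfl⟩, rfl⟩
    exact ⟨r, hr, _, ⟨φ y, hy, rfl⟩, by rw [hφ, map_smul]⟩
  · rintro ⟨r, hr, _, ⟨y, hy, rfl⟩, hx⟩
    refine ⟨r, hr, e.symm y, ⟨⟨e.symm y, by simp⟩, ?_, rfl⟩, ?_⟩
    · have h : φ ⟨e.symm y, by simp⟩ = y := Subtype.ext (by simp [hφ])
      rwa [h]
    · rw [← map_smul, hx, e.symm_apply_apply]

/-- The uniform probability measure on the unit sphere of `ℂ^d`. -/
def sphereMeasure (d : ℕ) : Measure (PureVec d) :=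
  ((volume : Measure (EuclideanSpace ℂ (Fin d))).toSphere Set.univ)⁻¹ •
    (volume : Measure (EuclideanSpace ℂ (Fin d))).toSphere

instance sphereMeasure_isProbabilityMeasure (d : ℕ) [NeZero d] :
    IsProbabilityMeasure (sphereMeasure d) := by
  have : NeZero (volume : Measure (EuclideanSpace ℂ (Fin d))).toSphere :=
    ⟨Measure.toSphere_ne_zero _⟩
  exact isProbabilityMeasureSMul

/-- The mean of a continuous function over the unit sphere of `ℂ^d`. -/
def sphereMean (d : ℕ) [NeZero d] : C(PureVec d, ℂ) →ₗ[ℂ] ℂ where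
  toFun f := ∫ ψ, f ψ ∂sphereMeasure d
  map_add' f g := integral_add
    (f.continuous.integrable_of_hasCompactSupport (HasCompactSupport.of_compactSpace _))
    (g.continuous.integrable_of_hasCompactSupport (HasCompactSupport.of_compactSpace _))
  map_smul' c f := integral_smul c f

lemma avg_re {d : ℕ} [NeZero d] (f : C(PureVec d, ℂ)) :
    avg (fun ψ => (f ψ).re) = (sphereMean d f).re :=
  integral_re
    (f.continuous.integrable_of_hasCompactSupport (HasCompactSupport.of_compactSpace _))

/-- The action of a unitary matrix on the unit sphere. -/
def unitaryOnSphere {d : ℕ} (U : Matrix (Fin d) (Fin d) ℂ) (hU : U ∈ Matrix.unitaryGroup (Fin d) ℂ) :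
    C(PureVec d, PureVec d) where
  toFun x := ⟨Unitary.linearIsometryEquiv
      ⟨Matrix.toEuclideanCLM (n := Fin d) (𝕜 := ℂ) U, Unitary.map_mem _ hU⟩ x.1, by simp⟩
  continuous_toFun := Continuous.subtype_mk
    ((LinearIsometryEquiv.continuous _).comp continuous_subtype_val) _

lemma unitaryOnSphere_apply {d : ℕ} (U : Matrix (Fin d) (Fin d) ℂ)
    (hU : U ∈ Matrix.unitaryGroup (Fin d) ℂ) (x : PureVec d) (i : Fin d) :
    (unitaryOnSphere U hU x).1 i = ∑ j, U i j * x.1 j := rfl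

lemma sphereMean_comp_unitary {d : ℕ} [NeZero d] (U : Matrix (Fin d) (Fin d) ℂ)
    (hU : U ∈ Matrix.unitaryGroup (Fin d) ℂ) (f : C(PureVec d, ℂ)) :
    sphereMean d (f.comp (unitaryOnSphere U hU)) = sphereMean d f := by
  have h := map_toSphere_linearIsometryEquiv (E := EuclideanSpace ℂ (Fin d))
    { toLinearEquiv := (Unitary.linearIsometryEquiv ⟨Matrix.toEuclideanCLM (n := Fin d) (𝕜 := ℂ) U,
        Unitary.map_mem _ hU⟩).toLinearEquiv.restrictScalars ℝ
      norm_map' := fun x => LinearIsometryEquiv.norm_map (Unitary.linearIsometryEquiv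
        ⟨Matrix.toEuclideanCLM (n := Fin d) (𝕜 := ℂ) U, Unitary.map_mem _ hU⟩) x }
    (φ := unitaryOnSphere U hU) fun _ => rfl
  have h' : (sphereMeasure d).map (unitaryOnSphere U hU) = sphereMeasure d := by
    rw [sphereMeasure, Measure.map_smul, h]
  change ∫ ψ, f (unitaryOnSphere U hU ψ) ∂sphereMeasure d = ∫ ψ, f ψ ∂sphereMeasure d
  conv_rhs => rw [← h']
  exact (integral_map (unitaryOnSphere U hU).continuous.aemeasurable
    f.continuous.aestronglyMeasurable).symm

/-- The `i`-th coordinate on the unit sphere. -/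
def coord {d : ℕ} (i : Fin d) : C(PureVec d, ℂ) where
  toFun ψ := ψ.1 i
  continuous_toFun := by fun_prop

lemma coord_comp_unitary {d : ℕ} (U : Matrix (Fin d) (Fin d) ℂ)
    (hU : U ∈ Matrix.unitaryGroup (Fin d) ℂ) (i : Fin d) :
    (coord i).comp (unitaryOnSphere U hU) = ∑ j, U i j • coord j := by
  ext x
  simp [coord, unitaryOnSphere_apply]

/-- The monomial `ψᵢ ψ̄ⱼ ψₖ ψ̄ₗ` on the unit sphere. -/
def quartic {d : ℕ} (i j k l : Fin d) : C(PureVec d, ℂ) :=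
  coord i * star (coord j) * coord k * star (coord l)

lemma quartic_comp_unitary {d : ℕ} (U : Matrix (Fin d) (Fin d) ℂ)
    (hU : U ∈ Matrix.unitaryGroup (Fin d) ℂ) (i j k l : Fin d) :
    (quartic i j k l).comp (unitaryOnSphere U hU) =
      (∑ a, U i a • coord a) * star (∑ a, U j a • coord a) * (∑ a, U k a • coord a) *
        star (∑ a, U l a • coord a) := by
  simp only [← coord_comp_unitary U hU]
  rfl

/-- Invariance under the diagonal unitary `diag z`. -/
lemma sphereMean_quartic_phase {d : ℕ} [NeZero d] (z : Fin d → ℂ) (hz : ∀ i, star (z i) * z i = 1)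
    (i j k l : Fin d) :
    z i * star (z j) * z k * star (z l) * sphereMean d (quartic i j k l) =
      sphereMean d (quartic i j k l) := by
  have hU : Matrix.diagonal z ∈ Matrix.unitaryGroup (Fin d) ℂ := by
    rw [Matrix.mem_unitaryGroup_iff', Matrix.star_eq_conjTranspose, Matrix.diagonal_conjTranspose,
      Matrix.diagonal_mul_diagonal, ← Matrix.diagonal_one]
    congr 1
    ext i
    exact hz i
  have h := sphereMean_comp_unitary _ hU (quartic i j k l)
  rw [quartic_comp_unitary] at h
  have e : ∀ i, ∑ a, Matrix.diagonal z i a • coord a = z i • coord i := fun i => by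
    ext x
    simp only [ContinuousMap.sum_apply, ContinuousMap.smul_apply, Matrix.diagonal_apply]
    simp
  simp only [e] at h
  conv_rhs => rw [← h]
  rw [← smul_eq_mul, ← map_smul]
  congr 1
  ext x
  change z i * star (z j) * z k * star (z l) *
      (coord i x * star (coord j x) * coord k x * star (coord l x)) =
    (z i * coord i x) * star (z j * coord j x) * (z k * coord k x) * star (z l * coord l x)
  simp only [star_mul']
  ring

/-- If the two unstarred indices do not match the two starred ones, some coordinate can be
multiplied by the phase `I` so that the monomial acquires a factor `I` or `-1`; invariance then
forces the mean to vanish. -/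
lemma sphereMean_quartic_eq_zero {d : ℕ} [NeZero d] {i j k l : Fin d}
    (h₁ : ¬ (i = j ∧ k = l)) (h₂ : ¬ (i = l ∧ k = j)) :
    sphereMean d (quartic i j k l) = 0 := by
  have key : ∀ m : Fin d, (fun x => if x = m then Complex.I else 1 : Fin d → ℂ) i *
      star ((fun x => if x = m then Complex.I else 1 : Fin d → ℂ) j) *
      (fun x => if x = m then Complex.I else 1 : Fin d → ℂ) k *
      star ((fun x => if x = m then Complex.I else 1 : Fin d → ℂ) l) ≠ 1 →
      sphereMean d (quartic i j k l) = 0 := fun m hm => by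
    have h := sphereMean_quartic_phase (fun x => if x = m then Complex.I else 1)
      (fun x => by split_ifs <;> simp) i j k l
    by_contra h0
    exact hm (mul_right_cancel₀ h0 (by rw [h, one_mul]))
  have hI : Complex.I ≠ 1 := fun h => by simpa using congrArg Complex.im h
  have hI2 : (-1 : ℂ) ≠ 1 := by norm_num
  have hI3 : -Complex.I ≠ 1 := fun h => by simpa using congrArg Complex.im h
  by_cases hij : i = j
  · subst hij
    have hkl : k ≠ l := fun h => h₁ ⟨rfl, h⟩
    refine key k ?_
    by_cases hik : i = k <;> simp [hik, hkl.symm, hI]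
  · by_cases hil : i = l
    · subst hil
      have hkj : k ≠ j := fun h => h₂ ⟨rfl, h⟩
      refine key k ?_
      by_cases hik : i = k <;> simp [hik, hkj.symm, hI]
    · refine key i ?_
      by_cases hik : k = i <;> simp [hik, Ne.symm hij, Ne.symm hil, hI, hI2]

/-- The reflection `1 - (2/5) w wᵀ` with `w = eᵢ + 2 eⱼ`. -/
lemma exists_rotation {d : ℕ} {i j : Fin d} (hij : i ≠ j) :
    ∃ U ∈ Matrix.unitaryGroup (Fin d) ℂ,
      ∑ a, U i a • coord a = (3 / 5 : ℂ) • coord i - (4 / 5 : ℂ) • coord j := by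
  let w : Fin d → ℂ := Pi.single i 1 + Pi.single j 2
  have hw : star w = w := by
    ext a
    simp only [w, Pi.star_apply, Pi.add_apply, Pi.single_apply]
    split_ifs <;> simp
  have hww : w ⬝ᵥ w = 5 := by
    simp [w, hij, hij.symm]
    norm_num
  refine ⟨1 - (2 / 5 : ℂ) • Matrix.vecMulVec w w, ?_, ?_⟩
  · rw [Matrix.mem_unitaryGroup_iff']
    have hs : star (1 - (2 / 5 : ℂ) • Matrix.vecMulVec w w) =
        1 - (2 / 5 : ℂ) • Matrix.vecMulVec w w := by
      rw [star_sub, star_one, star_smul, Matrix.star_eq_conjTranspose,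
        Matrix.conjTranspose_vecMulVec, hw]
      simp
    have h2 : Matrix.vecMulVec w w * Matrix.vecMulVec w w = (5 : ℂ) • Matrix.vecMulVec w w := by
      rw [Matrix.vecMulVec_mul_vecMulVec, hww]
      ext; simp [Matrix.vecMulVec_apply]; ring
    rw [hs]
    simp only [sub_mul, mul_sub, one_mul, mul_one, smul_mul_assoc, mul_smul_comm, h2, smul_smul]
    norm_num
    module
  · have e : ∀ a, (1 - (2 / 5 : ℂ) • Matrix.vecMulVec w w) i a =
        (if a = i then 3 / 5 else 0) - (if a = j then 4 / 5 else 0) := fun a => by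
      by_cases hai : a = i
      · subst hai
        simp [w, Matrix.vecMulVec_apply, hij]
        norm_num
      · by_cases haj : a = j
        · subst haj
          simp [w, Matrix.vecMulVec_apply, hij, hij.symm]
          norm_num
        · simp [w, Matrix.vecMulVec_apply, hij, hai, haj, Ne.symm hai]
    ext x
    simp only [ContinuousMap.sum_apply, ContinuousMap.smul_apply, ContinuousMap.sub_apply, e]
    simp [sub_mul, Finset.sum_sub_distrib]

lemma quartic_swap {d : ℕ} (i j k l : Fin d) : quartic i j k l = quartic i l k j := by
  ext x
  simp only [quartic, ContinuousMap.mul_apply]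
  ring

lemma sphereMean_quartic_perm {d : ℕ} [NeZero d] (σ : Equiv.Perm (Fin d)) (i j k l : Fin d) :
    sphereMean d (quartic (σ i) (σ j) (σ k) (σ l)) = sphereMean d (quartic i j k l) := by
  have hU : σ.permMatrix ℂ ∈ Matrix.unitaryGroup (Fin d) ℂ := by
    rw [Matrix.mem_unitaryGroup_iff', Matrix.star_eq_conjTranspose, Matrix.conjTranspose_permMatrix,
      ← Matrix.permMatrix_mul]
    simp
  have h := sphereMean_comp_unitary _ hU (quartic i j k l)
  rw [quartic_comp_unitary] at h
  have e : ∀ i, ∑ a, σ.permMatrix ℂ i a • coord a = coord (σ i) := fun i => by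
    ext x
    simp only [ContinuousMap.sum_apply, ContinuousMap.smul_apply]
    simp [Equiv.Perm.permMatrix, PEquiv.toMatrix_apply]
  simp only [e] at h
  exact h

/-- Phases and permutations cannot relate `|ψᵢ|⁴` to `|ψᵢ|² |ψⱼ|²`; a unitary mixing the two
coordinates does. The entries `3/5` and `-4/5` keep the arithmetic rational. -/
lemma sphereMean_quartic_self {d : ℕ} [NeZero d] {i j : Fin d} (hij : i ≠ j) :
    sphereMean d (quartic i i i i) = 2 * sphereMean d (quartic i i j j) := by
  obtain ⟨U, hU, hUi⟩ := exists_rotation hij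
  have h := sphereMean_comp_unitary _ hU (quartic i i i i)
  have hjj : sphereMean d (quartic j j j j) = sphereMean d (quartic i i i i) := by
    simpa using sphereMean_quartic_perm (Equiv.swap i j) i i i i
  rw [quartic_comp_unitary, hUi] at h
  have e : ((3 / 5 : ℂ) • coord i - (4 / 5 : ℂ) • coord j) *
      star ((3 / 5 : ℂ) • coord i - (4 / 5 : ℂ) • coord j) *
      ((3 / 5 : ℂ) • coord i - (4 / 5 : ℂ) • coord j) *
      star ((3 / 5 : ℂ) • coord i - (4 / 5 : ℂ) • coord j) =
      (81 / 625 : ℂ) • quartic i i i i + (256 / 625 : ℂ) • quartic j j j j +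
      (576 / 625 : ℂ) • quartic i i j j + (144 / 625 : ℂ) • quartic i j i j
      + (144 / 625 : ℂ) • quartic j i j i
      - (216 / 625 : ℂ) • quartic i i i j - (216 / 625 : ℂ) • quartic i i j i
      - (384 / 625 : ℂ) • quartic i j j j - (384 / 625 : ℂ) • quartic j i j j := by
    ext x
    simp [quartic]
    ring
  rw [e] at h
  simp only [map_add, map_sub, map_smul, hjj, smul_eq_mul] at h
  rw [sphereMean_quartic_eq_zero (i := i) (j := j) (k := i) (l := j) (by simp [hij]) (by simp [hij]),
    sphereMean_quartic_eq_zero (i := j) (j := i) (k := j) (l := i) (by simp [hij.symm])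
      (by simp [hij.symm]),
    sphereMean_quartic_eq_zero (i := i) (j := i) (k := i) (l := j) (by simp [hij]) (by simp [hij]),
    sphereMean_quartic_eq_zero (i := i) (j := i) (k := j) (l := i) (by simp [hij.symm])
      (by simp [hij.symm]),
    sphereMean_quartic_eq_zero (i := i) (j := j) (k := j) (l := j) (by simp [hij]) (by simp [hij]),
    sphereMean_quartic_eq_zero (i := j) (j := i) (k := j) (l := j) (by simp [hij.symm])
      (by simp [hij.symm])] at h
  -- What is left reads `m₄ = (81 + 256)/625 m₄ + 576/625 m₂₂`, and `625 - 81 - 256 = 288`.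
  linear_combination (-625 / 288 : ℂ) * h

lemma sum_coord_mul_star {d : ℕ} : ∑ i : Fin d, coord i * star (coord i) = 1 := by
  ext x
  have hx : ‖x.1‖ ^ 2 = 1 := by rw [norm_eq_of_mem_sphere]; norm_num
  rw [EuclideanSpace.norm_sq_eq] at hx
  have := congrArg (Complex.ofReal) hx
  push_cast at this
  simpa [coord, Complex.mul_conj, Complex.normSq_eq_norm_sq] using this

lemma sphereMean_one (d : ℕ) [NeZero d] : sphereMean d 1 = 1 := by
  change ∫ _, (1 : ℂ) ∂sphereMeasure d = 1
  simp

/-- The common constant is fixed by averaging `(∑ |ψᵢ|²)² = 1`, a sum with `d² + d` copies of it. -/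
lemma sphereMean_quartic_iijj {d : ℕ} [NeZero d] (i j : Fin d) :
    sphereMean d (quartic i i j j) = (1 + if i = j then 1 else 0) / (d * (d + 1)) := by
  have h4 : ∀ i j : Fin d, sphereMean d (quartic i i i i) = sphereMean d (quartic j j j j) :=
    fun i j => by simpa using sphereMean_quartic_perm (Equiv.swap j i) j j j j
  obtain ⟨c, h22⟩ : ∃ c : ℂ, ∀ i j : Fin d, sphereMean d (quartic i i j j) =
      (1 + if i = j then 1 else 0) * c := by
    refine ⟨sphereMean d (quartic 0 0 0 0) / 2, fun i j => ?_⟩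
    rw [h4 0 i]
    by_cases hij : i = j
    · subst hij
      simp
      ring
    · rw [sphereMean_quartic_self hij]
      simp [hij]
  have hsum : ∑ i, ∑ j, sphereMean d (quartic i i j j) = 1 := by
    rw [← sphereMean_one d, ← one_mul (1 : C(PureVec d, ℂ)), ← sum_coord_mul_star,
      Finset.sum_mul_sum, map_sum]
    refine Finset.sum_congr rfl fun i _ => ?_
    rw [map_sum]
    refine Finset.sum_congr rfl fun j _ => ?_
    rw [quartic, mul_assoc (coord i * star (coord i))]
  have hd : (d : ℂ) ≠ 0 := Nat.cast_ne_zero.2 (NeZero.ne d)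
  have hd1 : (d : ℂ) + 1 ≠ 0 := by exact_mod_cast Nat.succ_ne_zero d
  simp only [h22, ← Finset.sum_mul, Finset.sum_add_distrib] at hsum
  simp at hsum
  rw [h22, div_eq_mul_inv]
  congr 1
  field_simp
  linear_combination hsum

lemma sphereMean_quartic {d : ℕ} [NeZero d] (i j k l : Fin d) :
    sphereMean d (quartic i j k l) =
      ((if i = j then if k = l then 1 else 0 else 0) + if i = l then if k = j then 1 else 0 else 0) /
        (d * (d + 1)) := by
  by_cases h₁ : i = j ∧ k = l
  · obtain ⟨rfl, rfl⟩ := h₁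
    rw [sphereMean_quartic_iijj]
    by_cases h : i = k <;> simp [h]
  · by_cases h₂ : i = l ∧ k = j
    · obtain ⟨rfl, rfl⟩ := h₂
      rw [quartic_swap, sphereMean_quartic_iijj]
      by_cases h : i = k <;> simp [h]
    · rw [sphereMean_quartic_eq_zero h₁ h₂]
      rw [← ite_and, ← ite_and, if_neg h₁, if_neg h₂]
      simp

/-- Multiplication by `∑ |ψₖ|² = 1` reduces second moments to fourth ones. -/
lemma sphereMean_quadratic {d : ℕ} [NeZero d] (i j : Fin d) :
    sphereMean d (coord i * star (coord j)) = (if i = j then 1 else 0) / d := by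
  have hd : (d : ℂ) ≠ 0 := Nat.cast_ne_zero.2 (NeZero.ne d)
  have hd1 : (d : ℂ) + 1 ≠ 0 := by exact_mod_cast Nat.succ_ne_zero d
  have e : coord i * star (coord j) = ∑ k, quartic i j k k := by
    rw [← mul_one (coord i * star (coord j)), ← sum_coord_mul_star, Finset.mul_sum]
    refine Finset.sum_congr rfl fun k _ => ?_
    rw [quartic, mul_assoc (coord i * star (coord j))]
  rw [e, map_sum]
  rw [Finset.sum_congr rfl fun k _ => sphereMean_quartic i j k k]
  rw [← Finset.sum_div, Finset.sum_add_distrib]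
  by_cases h : i = j
  · subst h
    simp
    field_simp
  · rw [Finset.sum_eq_zero fun k _ => ?_, Finset.sum_eq_zero fun k _ => ?_]
    · simp [h]
    · by_cases hk : i = k
      · simp [← hk, h]
      · simp [hk]
    · simp [h]

/-! ### Twirling -/

/-- By Carathéodory's theorem `finrank + 1` points suffice, so the hull is a continuous image of the
compact set of weights and points. -/
lemma IsCompact.convexHull_of_finiteDimensional {E : Type*} [NormedAddCommGroup E]
    [NormedSpace ℝ E] [FiniteDimensional ℝ E] {K : Set E} (hK : IsCompact K) :
    IsCompact (convexHull ℝ K) := by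
  rcases K.eq_empty_or_nonempty with rfl | ⟨z₀, hz₀⟩
  · simp
  let n := Module.finrank ℝ E + 1
  have himg : convexHull ℝ K =
      (fun x : (Fin n → ℝ) × (Fin n → E) => ∑ i, x.1 i • x.2 i) ''
        (stdSimplex ℝ (Fin n) ×ˢ Set.pi Set.univ fun _ => K) := by
    ext x
    constructor
    · intro hx
      obtain ⟨ι, _, z, w, hz, hind, hw, hw1, hx⟩ := eq_pos_convex_span_of_mem_convexHull hx
      have hcard : Fintype.card ι ≤ Fintype.card (Fin n) := by
        simpa [n] using hind.card_le_finrank_succ.trans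
          (Nat.succ_le_succ (Submodule.finrank_le (vectorSpan ℝ (Set.range z))))
      obtain ⟨e⟩ := Function.Embedding.nonempty_of_card_le hcard
      have hout : ∀ i ∉ Set.range e, Function.extend e w 0 i = 0 := fun i hi =>
        Function.extend_apply' _ _ _ fun ⟨j, hj⟩ => hi ⟨j, hj⟩
      -- A shorter combination is padded with weight `0` at the point `z₀`.
      refine ⟨(Function.extend e w 0, Function.extend e z fun _ => z₀), ⟨⟨fun i => ?_, ?_⟩, ?_⟩, ?_⟩
      · by_cases hi : i ∈ Set.range e
        · obtain ⟨j, rfl⟩ := hi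
          simpa [e.injective.extend_apply] using (hw j).le
        · exact (hout i hi).ge
      · rw [← hw1]
        exact (Fintype.sum_of_injective e e.injective w _ hout
          fun i => (e.injective.extend_apply w 0 i).symm).symm
      · intro i _
        by_cases hi : i ∈ Set.range e
        · obtain ⟨j, rfl⟩ := hi
          simpa [e.injective.extend_apply] using hz ⟨j, rfl⟩
        · have : Function.extend e z (fun _ => z₀) i = z₀ :=
            Function.extend_apply' _ _ _ fun ⟨j, hj⟩ => hi ⟨j, hj⟩
          simpa [this] using hz₀
      · rw [← hx]
        refine (Fintype.sum_of_injective e e.injective (fun i => w i • z i) _ (fun i hi => ?_)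
          fun i => ?_).symm
        · simp only [hout i hi, zero_smul]
        · simp only [e.injective.extend_apply]
    · rintro ⟨⟨w, z⟩, ⟨hw, hz⟩, rfl⟩
      exact (convex_convexHull ℝ K).sum_mem (fun i _ => hw.1 i) hw.2
        fun i _ => subset_convexHull ℝ K (hz i trivial)
  rw [himg]
  exact ((isCompact_stdSimplex ℝ _).prod (isCompact_univ_pi fun _ => hK)).image (by fun_prop)

/-- The mean of a continuous function on a compact space is a finite convex combination of its
values. -/
lemma exists_finite_convex_combination {X E : Type} [TopologicalSpace X] [CompactSpace X]
    [MeasurableSpace X] [BorelSpace X] (μ : Measure X) [IsProbabilityMeasure μ]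
    [NormedAddCommGroup E] [NormedSpace ℝ E] [FiniteDimensional ℝ E] {f : X → E}
    (hf : Continuous f) (hfi : Integrable f μ) :
    ∃ (ι : Type) (_ : Fintype ι) (w : ι → ℝ) (x : ι → X), (∀ i, 0 ≤ w i) ∧ ∑ i, w i = 1 ∧
      ∫ y, f y ∂μ = ∑ i, w i • f (x i) := by
  have hK : IsCompact (convexHull ℝ (Set.range f)) :=
    (isCompact_range hf).convexHull_of_finiteDimensional
  have hmem := (convex_convexHull ℝ (Set.range f)).integral_mem (μ := μ) hK.isClosed
    (Filter.Eventually.of_forall fun y => subset_convexHull ℝ _ ⟨y, rfl⟩) hfi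
  obtain ⟨ι, _, w, z, hw, hw1, hz, hx⟩ := mem_convexHull_iff_exists_fintype.1 hmem
  choose x hx' using hz
  exact ⟨ι, inferInstance, w, x, hw, hw1, by simp only [hx', hx]⟩

instance haarU_isProbabilityMeasure (d : ℕ) : IsProbabilityMeasure (haarU d) := by
  have h := Measure.haarMeasure_self
    (K₀ := (⊤ : TopologicalSpace.PositiveCompacts (Matrix.unitaryGroup (Fin d) ℂ)))
  rw [TopologicalSpace.PositiveCompacts.coe_top] at h
  exact ⟨h⟩

lemma continuous_twirlU (d : ℕ) :
    Continuous fun U : Matrix.unitaryGroup (Fin d) ℂ => (twirlU U : Matrix _ _ ℂ) := by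
  refine continuous_matrix fun i j => ?_
  have h : ∀ x y : Fin d, Continuous fun U : Matrix.unitaryGroup (Fin d) ℂ => U.1 x y :=
    fun x y => continuous_subtype_val.matrix_elem x y
  exact (h i.1 j.1).mul (continuous_star.comp (h i.2 j.2))

lemma exists_finite_twirl (d : ℕ) :
    ∃ (ι : Type) (_ : Fintype ι) (w : ι → ℝ) (U : ι → Matrix.unitaryGroup (Fin d) ℂ),
      (∀ i, 0 ≤ w i) ∧ ∑ i, w i = 1 ∧
        ∀ X, twirl d X = ∑ i, (w i : ℂ) • (twirlU (U i) * X * (twirlU (U i))ᴴ) := by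
  -- All products of an entry of `U ⊗ U*` with a conjugate entry, taken together as one vector. The
  -- twirled matrix is linear in them, so the weights and unitaries found for `f` serve every `X` at
  -- once.
  let f : Matrix.unitaryGroup (Fin d) ℂ →
      ((Fin d × Fin d) × (Fin d × Fin d)) × ((Fin d × Fin d) × (Fin d × Fin d)) → ℂ :=
    fun U x => twirlU U x.1.1 x.1.2 * star (twirlU U x.2.1 x.2.2)
  have hf : Continuous f := continuous_pi fun x =>
    ((continuous_twirlU d).matrix_elem _ _).mul
      (continuous_star.comp ((continuous_twirlU d).matrix_elem _ _))
  have hfi : Integrable f (haarU d) :=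
    hf.integrable_of_hasCompactSupport (HasCompactSupport.of_compactSpace _)
  have hfx : ∀ x, Integrable (fun U => f U x) (haarU d) := fun x =>
    ((continuous_apply x).comp hf).integrable_of_hasCompactSupport
      (HasCompactSupport.of_compactSpace _)
  obtain ⟨ι, hι, w, U, hw, hw1, h⟩ := exists_finite_convex_combination (haarU d) hf hfi
  refine ⟨ι, hι, w, U, hw, hw1, fun X => ?_⟩
  have hentry : ∀ (V : Matrix.unitaryGroup (Fin d) ℂ) (p q : Fin d × Fin d),
      (twirlU V * X * (twirlU V)ᴴ) p q = ∑ s, ∑ r, X r s * f V ((p, r), (q, s)) := fun V p q => by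
    simp only [Matrix.mul_apply, Finset.sum_mul, Matrix.conjTranspose_apply, f]
    refine Finset.sum_congr rfl fun s _ => Finset.sum_congr rfl fun r _ => ?_
    ring
  have hx : ∀ x, ∫ V, f V x ∂haarU d = ∑ i, (w i : ℂ) * f (U i) x := fun x => by
    have := congrFun h x
    rw [eval_integral fun x => hfx x] at this
    rw [this]
    simp
  ext p q
  change ∫ V, (twirlU V * X * (twirlU V)ᴴ) p q ∂haarU d = _
  simp only [Matrix.sum_apply, Matrix.smul_apply, hentry, smul_eq_mul]
  rw [integral_finsetSum _ fun s _ => integrable_finsetSum _ fun r _ => (hfx _).const_mul _]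
  simp only [Finset.mul_sum]
  rw [Finset.sum_comm]
  refine Finset.sum_congr rfl fun s _ => ?_
  rw [integral_finsetSum _ fun r _ => (hfx _).const_mul _, Finset.sum_comm]
  refine Finset.sum_congr rfl fun r _ => ?_
  rw [integral_const_mul, hx, Finset.mul_sum]
  refine Finset.sum_congr rfl fun i _ => ?_
  ring

lemma map_star_mem_unitaryGroup {d : ℕ} {U : Matrix (Fin d) (Fin d) ℂ}
    (hU : U ∈ Matrix.unitaryGroup (Fin d) ℂ) : (U.map star)ᴴ * U.map star = 1 := by
  have h := congrArg Matrix.transpose (Matrix.mem_unitaryGroup_iff'.1 hU)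
  rw [Matrix.transpose_mul, Matrix.transpose_one] at h
  rw [← h]
  ext i j
  simp [Matrix.mul_apply, Matrix.conjTranspose_apply, Matrix.star_apply]

lemma krausMap_smul {p q : Type} [Fintype p] (c : ℂ) (K : Matrix q p ℂ) :
    krausMap (c • K) = (c * star c) • krausMap K := by
  ext1 X
  simp [smul_smul, Matrix.conjTranspose_smul, mul_comm]

/-- The probability of the `i`-th unitary, as the factor `√wᵢ`, can be put on either side; this
decides which party draws `i` and announces it. -/
lemma exists_twirl_eq_sum_krausMap (d : ℕ) :
    ∃ (ι : Type) (_ : Fintype ι) (K V : ι → Matrix (Fin d) (Fin d) ℂ) (K' V' : ι → Matrix (Fin d) (Fin d) ℂ),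
      ∑ i, (K i)ᴴ * K i = 1 ∧ (∀ i, (V i)ᴴ * V i = 1) ∧ ∑ i, (K' i)ᴴ * K' i = 1 ∧
      (∀ i, (V' i)ᴴ * V' i = 1) ∧ twirl d = ∑ i, krausMap (K i ⊗ₖ V i) ∧
      twirl d = ∑ i, krausMap (V' i ⊗ₖ K' i) := by
  obtain ⟨ι, hι, w, U, hw, hw1, h⟩ := exists_finite_twirl d
  have hU : ∀ i, (U i).1ᴴ * (U i).1 = 1 := fun i => Matrix.mem_unitaryGroup_iff'.1 (U i).2
  have hU' : ∀ i, ((U i).1.map star)ᴴ * (U i).1.map star = 1 := fun i =>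
    map_star_mem_unitaryGroup (U i).2
  have hw' : ∀ i, ((Real.sqrt (w i) : ℝ) : ℂ) * star ((Real.sqrt (w i) : ℝ) : ℂ) = w i := fun i => by
    simp [← Complex.ofReal_mul, Real.mul_self_sqrt (hw i)]
  have hgram : ∀ V : ι → Matrix (Fin d) (Fin d) ℂ, (∀ i, (V i)ᴴ * V i = 1) →
      ∑ i, (((Real.sqrt (w i) : ℝ) : ℂ) • V i)ᴴ * (((Real.sqrt (w i) : ℝ) : ℂ) • V i) = 1 := by
    intro V hV
    simp only [Matrix.conjTranspose_smul, Matrix.smul_mul, Matrix.mul_smul, smul_smul, hV]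
    rw [← Finset.sum_smul]
    simp only [hw', ← Complex.ofReal_sum, hw1, Complex.ofReal_one, one_smul]
  refine ⟨ι, hι, fun i => ((Real.sqrt (w i) : ℝ) : ℂ) • (U i).1, fun i => (U i).1.map star,
    fun i => ((Real.sqrt (w i) : ℝ) : ℂ) • (U i).1.map star, fun i => (U i).1, hgram _ hU, hU',
    hgram _ hU', hU, ?_, ?_⟩
  · ext1 X
    rw [h, LinearMap.sum_apply]
    refine Finset.sum_congr rfl fun i _ => ?_
    rw [Matrix.smul_kronecker, krausMap_smul, hw']
    rfl
  · ext1 X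
    rw [h, LinearMap.sum_apply]
    refine Finset.sum_congr rfl fun i _ => ?_
    rw [Matrix.kronecker_smul, krausMap_smul, hw']
    rfl

lemma isLOCC_twirl (c : Comm) (k : OpKind) (d : ℕ) : IsLOCC c k (twirl d) := by
  obtain ⟨ι, hι, K, V, K', V', hK, hV, hK', hV', h₁, h₂⟩ := exists_twirl_eq_sum_krausMap d
  have hA : IsAliceToBob k (twirl d) := by
    have h := isAliceToBob_of_fintype (k := k) K (fun i (_ : Unit) => V i)
      (by rw [hK]; exact admissible_one k) (by simpa using hV)
    simp only [Finset.univ_unique, Finset.sum_singleton] at h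
    rwa [h₁]
  rcases c with (_ | _) | _
  · exact hA
  · rw [← isLOCC_swap_iff]
    have h := isAliceToBob_of_fintype (k := k) K' (fun i (_ : Unit) => V' i)
      (by rw [hK']; exact admissible_one k) (by simpa using hV')
    simp only [Finset.univ_unique, Finset.sum_singleton] at h
    rw [h₂]
    simp only [swapMap_sum, swapMap_krausMap]
    exact h
  · exact hA.isTwoWay

/-! ### Singlet fraction -/

lemma dotProduct_krausMap {p q : Type} [Fintype p] [Fintype q] (K : Matrix q p ℂ)
    (X : Matrix p p ℂ) (v : q → ℂ) :
    star v ⬝ᵥ (krausMap K X *ᵥ v) = star (Kᴴ *ᵥ v) ⬝ᵥ (X *ᵥ (Kᴴ *ᵥ v)) := by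
  rw [krausMap_apply, ← Matrix.mulVec_mulVec, ← Matrix.mulVec_mulVec, Matrix.dotProduct_mulVec,
    Matrix.star_mulVec, Matrix.conjTranspose_conjTranspose]

lemma singletFraction_eq_sum {d : ℕ} (σ : Matrix (Fin d × Fin d) (Fin d × Fin d) ℂ) :
    singletFraction σ = (∑ x, ∑ y, σ (x, x) (y, y)).re / d := by
  have hd : ((1 / Real.sqrt d : ℝ) : ℂ) * ((1 / Real.sqrt d : ℝ) : ℂ) = ((1 / d : ℝ) : ℂ) := by
    rw [← Complex.ofReal_mul, div_mul_div_comm, one_mul, Real.mul_self_sqrt (Nat.cast_nonneg d)]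
  have h : star (maxEntVec d) ⬝ᵥ (σ *ᵥ maxEntVec d) =
      ((1 / d : ℝ) : ℂ) * ∑ x, ∑ y, σ (x, x) (y, y) := by
    rw [← hd]
    simp only [dotProduct, Matrix.mulVec, Fintype.sum_prod_type, maxEntVec, Pi.star_apply,
      Finset.mul_sum]
    refine Finset.sum_congr rfl fun x _ => ?_
    rw [Finset.sum_eq_single x]
    · refine Finset.sum_congr rfl fun y _ => ?_
      rw [Finset.sum_eq_single y]
      · simp only [if_true, Complex.star_def, Complex.conj_ofReal]
        ring
      · intro b _ hb
        simp [hb.symm]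
      · simp
    · intro b _ hb
      simp [hb.symm]
    · simp
  rw [singletFraction, h, Complex.re_ofReal_mul]
  ring

/-! ### Teleportation as a state -/

/-- The input `|m⟩⟨n| ⊗ σ` of a teleportation protocol from Alice. -/
def inputBlock {d : ℕ} (m n : Fin d) (σ : Matrix (Fin d × Fin d) (Fin d × Fin d) ℂ) :
    Matrix ((Fin d × Fin d) × Fin d) ((Fin d × Fin d) × Fin d) ℂ :=
  Matrix.of fun p q => if p.1.1 = m ∧ q.1.1 = n then σ (p.1.2, p.2) (q.1.2, q.2) else 0

/-- The state obtained by teleporting half of a maximally entangled pair of Alice. -/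
def telChoi {d : ℕ} (T : BiMap (Fin d × Fin d) (Fin d) Unit (Fin d))
    (σ : Matrix (Fin d × Fin d) (Fin d × Fin d) ℂ) : Matrix (Fin d × Fin d) (Fin d × Fin d) ℂ :=
  Matrix.of fun p q => (1 / d : ℂ) * T (inputBlock p.1 q.1 σ) ((), p.2) ((), q.2)

lemma telOutput_alice_apply {d : ℕ} (σ : Matrix (Fin d × Fin d) (Fin d × Fin d) ℂ) (ψ : PureVec d)
    (T : BiMap (Fin d × Fin d) (Fin d) Unit (Fin d)) (x y : Fin d) :
    telOutput σ ψ .alice T x y =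
      ∑ m, ∑ n, T (inputBlock m n σ) ((), x) ((), y) * (coord m ψ * star (coord n ψ)) := by
  have h : (Matrix.of fun p q : (Fin d × Fin d) × Fin d =>
      ψ.1 p.1.1 * star (ψ.1 q.1.1) * σ (p.1.2, p.2) (q.1.2, q.2)) =
      ∑ m, ∑ n, (coord m ψ * star (coord n ψ)) • inputBlock m n σ := by
    ext p q
    simp only [Matrix.sum_apply, Matrix.smul_apply, inputBlock, Matrix.of_apply, smul_eq_mul]
    rw [Finset.sum_eq_single p.1.1, Finset.sum_eq_single q.1.1]
    · simp [coord]
    · intro b _ hb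
      simp [hb.symm]
    · simp
    · intro b _ hb
      simp [hb.symm]
    · simp
  change T _ ((), x) ((), y) = _
  rw [h]
  simp only [map_sum, map_smul, Matrix.sum_apply, Matrix.smul_apply, smul_eq_mul]
  exact Finset.sum_congr rfl fun m _ => Finset.sum_congr rfl fun n _ => mul_comm _ _

/-- The second moments `δₘₙ / d` retain the diagonal input blocks, with the same factor `1 / d` as
in `telChoi`. -/
lemma telProb_alice {d : ℕ} [NeZero d] (σ : Matrix (Fin d × Fin d) (Fin d × Fin d) ℂ)
    (T : BiMap (Fin d × Fin d) (Fin d) Unit (Fin d)) :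
    telProb σ .alice T = (telChoi T σ).trace.re := by
  let f : C(PureVec d, ℂ) := ∑ x, ∑ m, ∑ n,
    T (inputBlock m n σ) ((), x) ((), x) • (coord m * star (coord n))
  have hf : ∀ ψ, (telOutput σ ψ .alice T).trace = f ψ := fun ψ => by
    simp only [Matrix.trace, Matrix.diag_apply, telOutput_alice_apply, f, ContinuousMap.sum_apply]
    rfl
  have h : sphereMean d f = (telChoi T σ).trace := by
    simp only [f, map_sum, map_smul, sphereMean_quadratic, Matrix.trace, Matrix.diag_apply,
      Fintype.sum_prod_type, telChoi, Matrix.of_apply, smul_eq_mul]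
    rw [Finset.sum_comm]
    refine Finset.sum_congr rfl fun m _ => Finset.sum_congr rfl fun x _ => ?_
    rw [Finset.sum_eq_single m]
    · simp only [if_true]
      ring
    · intro b _ hb
      simp [hb.symm]
    · simp
  change avg (fun ψ => (telOutput σ ψ .alice T).trace.re) = _
  simp only [hf]
  rw [avg_re, h]

/-- Of the two pairings in the fourth moments, one produces the trace of `telChoi` and the other the
sum that is `d` times its singlet fraction. -/
lemma telFidelity_alice {d : ℕ} [NeZero d] (σ : Matrix (Fin d × Fin d) (Fin d × Fin d) ℂ)
    (T : BiMap (Fin d × Fin d) (Fin d) Unit (Fin d)) :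
    telFidelity σ .alice T = ((telChoi T σ).trace.re + d * singletFraction (telChoi T σ)) / (d + 1) /
      (telChoi T σ).trace.re := by
  have hd : (d : ℂ) ≠ 0 := Nat.cast_ne_zero.2 (NeZero.ne d)
  have hd1 : (d : ℂ) + 1 ≠ 0 := by exact_mod_cast Nat.succ_ne_zero d
  let f : C(PureVec d, ℂ) := ∑ x, ∑ y, ∑ m, ∑ n,
    T (inputBlock m n σ) ((), x) ((), y) • quartic m n y x
  have hf : ∀ ψ, star (fun i => ψ.1 i) ⬝ᵥ (telOutput σ ψ .alice T *ᵥ fun i => ψ.1 i) = f ψ :=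
    fun ψ => by
      simp only [dotProduct, Matrix.mulVec, telOutput_alice_apply, f, ContinuousMap.sum_apply,
        Finset.mul_sum, Finset.sum_mul]
      refine Finset.sum_congr rfl fun x _ => Finset.sum_congr rfl fun y _ =>
        Finset.sum_congr rfl fun m _ => Finset.sum_congr rfl fun n _ => ?_
      change star (coord x ψ) * (T (inputBlock m n σ) ((), x) ((), y) *
          (coord m ψ * star (coord n ψ)) * coord y ψ) = T (inputBlock m n σ) ((), x) ((), y) *
        (coord m ψ * star (coord n ψ) * coord y ψ * star (coord x ψ))
      ring
  have h : sphereMean d f = ((telChoi T σ).trace + ∑ x, ∑ y, telChoi T σ (x, x) (y, y)) /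
      ((d : ℂ) + 1) := by
    have h1 : ∀ x y m : Fin d, ∑ n, T (inputBlock m n σ) ((), x) ((), y) *
        ((((if m = n then if y = x then 1 else 0 else 0) +
          if m = x then if y = n then 1 else 0 else 0) : ℂ) / (d * (d + 1))) =
        ((if y = x then T (inputBlock m m σ) ((), x) ((), y) else 0) +
          if m = x then T (inputBlock m y σ) ((), x) ((), y) else 0) / (d * (d + 1)) := by
      intro x y m
      simp only [← mul_div_assoc, mul_add]
      rw [← Finset.sum_div, Finset.sum_add_distrib]
      congr 2
      · rw [Finset.sum_eq_single m]
        · simp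
        · intro b _ hb
          simp [hb.symm]
        · simp
      · rw [Finset.sum_eq_single y]
        · simp
        · intro b _ hb
          simp [hb.symm]
        · simp
    simp only [f, map_sum, map_smul, sphereMean_quartic, smul_eq_mul, h1]
    simp only [Matrix.trace, Matrix.diag_apply,
      Fintype.sum_prod_type, telChoi, Matrix.of_apply, ← Finset.mul_sum]
    simp only [← Finset.sum_div, Finset.sum_add_distrib]
    have h2 : ∑ x : Fin d, ∑ y : Fin d, ∑ m : Fin d,
        (if y = x then T (inputBlock m m σ) ((), x) ((), y) else 0) =
        ∑ m, ∑ x, T (inputBlock m m σ) ((), x) ((), x) := by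
      rw [Finset.sum_comm (f := fun m x => T (inputBlock m m σ) ((), x) ((), x))]
      refine Finset.sum_congr rfl fun x _ => ?_
      rw [Finset.sum_eq_single x]
      · simp
      · intro b _ hb
        simp [hb]
      · simp
    have h3 : ∑ x : Fin d, ∑ y : Fin d, ∑ m : Fin d,
        (if m = x then T (inputBlock m y σ) ((), x) ((), y) else 0) =
        ∑ x, ∑ y, T (inputBlock x y σ) ((), x) ((), y) := by
      simp
    rw [h2, h3]
    field_simp
  have h' : avg (fun ψ => (star (fun i => ψ.1 i) ⬝ᵥ
      (telOutput σ ψ .alice T *ᵥ fun i => ψ.1 i)).re) =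
      ((telChoi T σ).trace.re + d * singletFraction (telChoi T σ)) / (d + 1) := by
    simp only [hf]
    have hdr : (d : ℝ) ≠ 0 := Nat.cast_ne_zero.2 (NeZero.ne d)
    have hc : ((d : ℂ) + 1) = ((d + 1 : ℝ) : ℂ) := by push_cast; rfl
    rw [avg_re, h, hc, Complex.div_ofReal_re, Complex.add_re, singletFraction_eq_sum]
    field_simp
  change avg (fun ψ => (star (fun i => ψ.1 i) ⬝ᵥ
    (telOutput σ ψ .alice T *ᵥ fun i => ψ.1 i)).re) / telProb σ .alice T = _
  rw [h', telProb_alice]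

/-- Preparation of a maximally entangled pair of Alice next to her system. -/
def prepEnt (d : ℕ) : Matrix (Fin d × (Fin d × Fin d)) (Fin d) ℂ :=
  Matrix.of fun p a => if p.1 = p.2.1 ∧ p.2.2 = a then ((1 / Real.sqrt d : ℝ) : ℂ) else 0

lemma inv_sqrt_mul_inv_sqrt (d : ℕ) :
    ((1 / Real.sqrt d : ℝ) : ℂ) * ((1 / Real.sqrt d : ℝ) : ℂ) = 1 / d := by
  rw [← Complex.ofReal_mul, div_mul_div_comm, one_mul, Real.mul_self_sqrt (Nat.cast_nonneg d)]
  push_cast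
  rfl

lemma prepEnt_isometry (d : ℕ) [NeZero d] : (prepEnt d)ᴴ * prepEnt d = 1 := by
  have hd : (d : ℂ) ≠ 0 := Nat.cast_ne_zero.2 (NeZero.ne d)
  ext a b
  simp only [Matrix.mul_apply, Matrix.conjTranspose_apply, prepEnt, Matrix.of_apply,
    Fintype.sum_prod_type]
  have h : ∀ x y z : Fin d, star (if x = y ∧ z = a then ((1 / Real.sqrt d : ℝ) : ℂ) else 0) *
      (if x = y ∧ z = b then ((1 / Real.sqrt d : ℝ) : ℂ) else 0) =
      if x = y then if z = a then if z = b then (1 / d : ℂ) else 0 else 0 else 0 := by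
    intro x y z
    rw [← inv_sqrt_mul_inv_sqrt]
    by_cases h₁ : x = y <;> by_cases h₂ : z = a <;> by_cases h₃ : z = b <;>
      simp [h₁, h₂, h₃]
    all_goals simp_all
  simp only [h]
  by_cases hab : a = b
  · subst hab
    simp [hd]
  · simp [hab]

/-- Removal of the trivial system. -/
def dropUnit (d : ℕ) : Matrix (Fin d) (Fin d × Unit) ℂ :=
  Matrix.of fun x p => if x = p.1 then 1 else 0

lemma dropUnit_isometry (d : ℕ) : (dropUnit d)ᴴ * dropUnit d = 1 := by
  ext a b
  simp [Matrix.mul_apply, dropUnit, Matrix.one_apply, Prod.ext_iff, eq_comm]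

/-- The operational meaning of `telChoi`: Alice prepares the pair, runs the protocol on one half
with the other half as idle ancilla, and drops her trivial system. -/
lemma telChoi_eq {d : ℕ} (T : BiMap (Fin d × Fin d) (Fin d) Unit (Fin d))
    (σ : Matrix (Fin d × Fin d) (Fin d × Fin d) ℂ) :
    telChoi T σ = (krausMap (dropUnit d ⊗ₖ (1 : Matrix (Fin d) (Fin d) ℂ)) ∘ₗ ampMap (Fin d) T ∘ₗ
      krausMap (prepEnt d ⊗ₖ (1 : Matrix (Fin d) (Fin d) ℂ))) σ := by
  have h1 : ∀ x y : Fin d, (krausMap (prepEnt d ⊗ₖ (1 : Matrix (Fin d) (Fin d) ℂ)) σ).submatrix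
      (fun r => ((x, r.1), r.2)) (fun s => ((y, s.1), s.2)) = (1 / d : ℂ) • inputBlock x y σ := by
    intro x y
    ext p q
    simp only [Matrix.submatrix_apply, krausMap_apply, Matrix.mul_apply, Matrix.conjTranspose_apply,
      Matrix.kroneckerMap_apply, Fintype.sum_prod_type, prepEnt, Matrix.of_apply, Matrix.one_apply,
      Matrix.smul_apply, inputBlock, ← inv_sqrt_mul_inv_sqrt, smul_eq_mul]
    rw [Finset.sum_eq_single q.1.2, Finset.sum_eq_single q.2, Finset.sum_eq_single p.1.2,
      Finset.sum_eq_single p.2]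
    · by_cases hx : p.1.1 = x <;> by_cases hy : q.1.1 = y <;>
        simp [hx, hy, eq_comm (a := x), eq_comm (a := y)]
      ring
    all_goals first
      | exact fun h => absurd (Finset.mem_univ _) h
      | intro b _ hb
        simp [hb.symm]
  ext p q
  simp only [LinearMap.comp_apply]
  generalize hX : krausMap (prepEnt d ⊗ₖ (1 : Matrix (Fin d) (Fin d) ℂ)) σ = X at h1 ⊢
  have h2 : ∀ Y : Matrix ((Fin d × Unit) × Fin d) ((Fin d × Unit) × Fin d) ℂ,
      krausMap (dropUnit d ⊗ₖ (1 : Matrix (Fin d) (Fin d) ℂ)) Y p q =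
        Y ((p.1, ()), p.2) ((q.1, ()), q.2) := by
    intro Y
    simp [Matrix.mul_apply, Fintype.sum_prod_type, dropUnit, Matrix.one_apply,
      Matrix.kroneckerMap_apply, apply_ite (starRingEnd ℂ)]
  rw [h2, ampMap_apply, h1, map_smul]
  rfl

lemma isLOCC_telChoi {c : Comm} {k : OpKind} {d : ℕ} [NeZero d]
    {T : BiMap (Fin d × Fin d) (Fin d) Unit (Fin d)} (hT : IsLOCC c k T) :
    IsLOCC c k (krausMap (dropUnit d ⊗ₖ (1 : Matrix (Fin d) (Fin d) ℂ)) ∘ₗ ampMap (Fin d) T ∘ₗ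
      krausMap (prepEnt d ⊗ₖ (1 : Matrix (Fin d) (Fin d) ℂ))) :=
  (isLOCC_isometry _ (dropUnit_isometry d)).comp
    (hT.ampMap.comp (isLOCC_isometry _ (prepEnt_isometry d)))

/-! ### Standard teleportation -/

lemma sum_pow_eq_zero_of_pow_eq_one {d : ℕ} {z : ℂ} (hz : z ^ d = 1) (hz1 : z ≠ 1) :
    ∑ β : Fin d, z ^ (β : ℕ) = 0 := by
  rw [Fin.sum_univ_eq_sum_range (fun n => z ^ n) d]
  have h := geom_sum_mul z d
  rw [hz, sub_self] at h
  exact (mul_eq_zero.1 h).resolve_right (sub_ne_zero.2 hz1)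

/-- The shift and phase unitaries form an orthogonal basis of the matrices. -/
lemma exists_weyl (d : ℕ) [NeZero d] : ∃ W : Fin d × Fin d → Matrix (Fin d) (Fin d) ℂ,
    (∀ k, (W k)ᴴ * W k = 1) ∧ ∀ m a m' a', ∑ k, W k m a * star (W k m' a') =
      if m = m' then if a = a' then (d : ℂ) else 0 else 0 := by
  have hd : d ≠ 0 := NeZero.ne d
  obtain ⟨ω, hω⟩ : ∃ ω : ℂ, IsPrimitiveRoot ω d := ⟨_, Complex.isPrimitiveRoot_exp d hd⟩
  have hω0 : ω ≠ 0 := hω.ne_zero hd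
  have hnorm : ‖ω‖ = 1 := hω.norm'_eq_one hd
  have hstar : star ω * ω = 1 := by
    rw [Complex.star_def, ← Complex.normSq_eq_conj_mul_self, Complex.normSq_eq_norm_sq, hnorm]
    simp
  have hstar' : ∀ n : ℕ, star (ω ^ n) * ω ^ n = 1 := fun n => by
    rw [star_pow, ← mul_pow, hstar, one_pow]
  -- The product of the cyclic shift by `k.1` and the phases `ω ^ (k.2 * y)`; the sum `y + k.1` is
  -- taken modulo `d`.
  refine ⟨fun k => Matrix.of fun x y => if x = y + k.1 then ω ^ ((k.2 : ℕ) * (y : ℕ)) else 0,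
    fun k => ?_, fun m a m' a' => ?_⟩
  · ext a b
    simp only [Matrix.mul_apply, Matrix.conjTranspose_apply, Matrix.of_apply, Matrix.one_apply]
    rw [Finset.sum_eq_single (b + k.1)]
    · by_cases hab : a = b
      · subst hab
        simp only [if_true]
        exact hstar' _
      · simp [hab, Ne.symm hab]
    · intro x _ hx
      simp [hx]
    · simp
  · simp only [Matrix.of_apply, Fintype.sum_prod_type]
    -- Only the shift `m - a` sends `a` to `m`. For `a ≠ a'` the sum over the phases is either zero
    -- termwise or the sum of the powers of a `d`-th root of unity other than `1`.
    rw [Finset.sum_eq_single (m - a)]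
    · by_cases haa : a = a'
      · subst haa
        by_cases hm : m = m'
        · subst hm
          simp only [add_sub_cancel, if_true]
          simp only [mul_comm (ω ^ _), hstar']
          simp
        · simp [Ne.symm hm, hm]
      · by_cases hm : m' = a' + (m - a)
        · simp only [add_sub_cancel, ← hm, if_true, if_neg haa, ite_self]
          have e : ∀ β : Fin d, ω ^ ((β : ℕ) * (a : ℕ)) * star (ω ^ ((β : ℕ) * (a' : ℕ))) =
              (ω ^ (a : ℕ) * star (ω ^ (a' : ℕ))) ^ (β : ℕ) := fun β => by
            rw [mul_pow, ← star_pow, ← pow_mul, ← pow_mul, mul_comm (a : ℕ), mul_comm (a' : ℕ)]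
          simp only [e]
          refine sum_pow_eq_zero_of_pow_eq_one ?_ fun h => haa ?_
          · rw [mul_pow, ← star_pow, ← pow_mul, ← pow_mul, mul_comm (a : ℕ), mul_comm (a' : ℕ),
              pow_mul, pow_mul, hω.pow_eq_one]
            simp
          · have h' : ω ^ (a : ℕ) = ω ^ (a' : ℕ) := by
              have := congrArg (· * ω ^ (a' : ℕ)) h
              simpa only [mul_assoc, hstar', mul_one, one_mul] using this
            exact Fin.ext (hω.pow_inj a.2 a'.2 h')
        · simp [hm, haa]
    · intro α _ hα
      have : m ≠ a + α := fun h => hα (by rw [h]; abel)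
      simp [this]
    · simp

/-- The vector `Ψ₊` is fixed by the adjoint of `U* ⊗ U`. -/
lemma singletFraction_krausMap_unitary {d : ℕ} {U : Matrix (Fin d) (Fin d) ℂ} (hU : Uᴴ * U = 1)
    (σ : Matrix (Fin d × Fin d) (Fin d × Fin d) ℂ) :
    singletFraction (krausMap (U.map star ⊗ₖ U) σ) = singletFraction σ := by
  have h : (U.map star ⊗ₖ U)ᴴ *ᵥ maxEntVec d = maxEntVec d := by
    ext ⟨a, b⟩
    have hab := congrFun (congrFun hU b) a
    simp only [Matrix.mul_apply, Matrix.conjTranspose_apply, Matrix.one_apply] at hab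
    simp only [Matrix.mulVec, dotProduct, Fintype.sum_prod_type, maxEntVec,
      Matrix.conjTranspose_apply, Matrix.kroneckerMap_apply, Matrix.map_apply, star_mul', star_star]
    have : ∀ x : Fin d, ∑ y, U x a * star (U y b) * (if x = y then ((1 / Real.sqrt d : ℝ) : ℂ) else 0)
        = star (U x b) * U x a * ((1 / Real.sqrt d : ℝ) : ℂ) := fun x => by
      rw [Finset.sum_eq_single x]
      · simp only [if_true]
        ring
      · intro y _ hy
        simp [hy.symm]
      · simp
    simp only [this]
    rw [← Finset.sum_mul, hab]
    by_cases h : a = b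
    · simp [h]
    · simp [h, Ne.symm h]
  rw [singletFraction, dotProduct_krausMap, h, singletFraction]

lemma trace_krausMap_isometry {p q : Type} [Fintype p] [Fintype q] [DecidableEq p]
    {K : Matrix q p ℂ} (hK : Kᴴ * K = 1) (X : Matrix p p ℂ) : (krausMap K X).trace = X.trace := by
  rw [krausMap_apply, Matrix.trace_mul_comm, ← Matrix.mul_assoc, hK, Matrix.one_mul]

lemma singletFraction_add {d : ℕ} (σ τ : Matrix (Fin d × Fin d) (Fin d × Fin d) ℂ) :
    singletFraction (σ + τ) = singletFraction σ + singletFraction τ := by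
  simp [singletFraction, Matrix.add_mulVec, dotProduct_add]

lemma singletFraction_smul {d : ℕ} (c : ℝ) (σ : Matrix (Fin d × Fin d) (Fin d × Fin d) ℂ) :
    singletFraction ((c : ℂ) • σ) = c * singletFraction σ := by
  simp [singletFraction, Matrix.smul_mulVec, dotProduct_smul]

lemma singletFraction_sum {d : ℕ} {ι : Type*} (s : Finset ι)
    (σ : ι → Matrix (Fin d × Fin d) (Fin d × Fin d) ℂ) :
    singletFraction (∑ i ∈ s, σ i) = ∑ i ∈ s, singletFraction (σ i) := by
  simp [singletFraction, Matrix.sum_mulVec, dotProduct_sum]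

/-- Teleportation protocols from Alice that conserve the trace and the singlet fraction of the
shared matrix. -/
lemma exists_teleportation (d : ℕ) [NeZero d] :
    ∃ T : BiMap (Fin d × Fin d) (Fin d) Unit (Fin d), (∀ k, IsAliceToBob k T) ∧
      ∀ σ, (telChoi T σ).trace = σ.trace ∧ singletFraction (telChoi T σ) = singletFraction σ := by
  obtain ⟨W, hW, hcomp⟩ := exists_weyl d
  have hd : (d : ℂ) ≠ 0 := Nat.cast_ne_zero.2 (NeZero.ne d)
  have hdr : (d : ℝ) ≠ 0 := Nat.cast_ne_zero.2 (NeZero.ne d)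
  -- The bras of the maximally entangled vectors with coefficients `d^{-1/2} W k`; the orthogonality
  -- relation `hcomp` makes this measurement complete.
  let K : Fin d × Fin d → Matrix Unit (Fin d × Fin d) ℂ := fun k =>
    Matrix.of fun _ p => ((1 / Real.sqrt d : ℝ) : ℂ) * star (W k p.1 p.2)
  have hK : ∑ k, (K k)ᴴ * K k = 1 := by
    ext p q
    have h : ∀ k, ((K k)ᴴ * K k) p q = (1 / d : ℂ) * (W k p.1 p.2 * star (W k q.1 q.2)) := by
      intro k
      rw [← inv_sqrt_mul_inv_sqrt]
      simp only [Matrix.mul_apply, Matrix.conjTranspose_apply, K, Matrix.of_apply,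
        Finset.univ_unique, Finset.sum_singleton, star_mul', Complex.star_def,
        Complex.conj_ofReal, Complex.conj_conj]
      ring
    simp only [Matrix.sum_apply, h]
    rw [← Finset.mul_sum, hcomp, Matrix.one_apply]
    by_cases h₁ : p.1 = q.1 <;> by_cases h₂ : p.2 = q.2 <;> simp [Prod.ext_iff, h₁, h₂, hd]
  refine ⟨∑ k, krausMap (K k ⊗ₖ W k), fun k => ?_, fun σ => ?_⟩
  · have h := isAliceToBob_of_fintype (k := k) K (fun i (_ : Unit) => W i)
      (by rw [hK]; exact admissible_one k) (by simpa using hW)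
    simpa only [Finset.univ_unique, Finset.sum_singleton] using h
  -- With Bob's correction `W k`, outcome `k` leaves `σ` conjugated by `W̄ₖ ⊗ Wₖ`. One factor `1 /
  -- d` is from `telChoi`, the other from the measurement; the `d²` outcomes compensate both.
  have hchoi : telChoi (∑ k, krausMap (K k ⊗ₖ W k)) σ =
      ∑ k, (((1 / d : ℝ) * (1 / d : ℝ) : ℝ) : ℂ) • krausMap ((W k).map star ⊗ₖ W k) σ := by
    ext p q
    simp only [telChoi, Matrix.of_apply, LinearMap.sum_apply, Matrix.sum_apply, Finset.mul_sum,
      Matrix.smul_apply, smul_eq_mul]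
    refine Finset.sum_congr rfl fun k _ => ?_
    push_cast
    rw [mul_assoc]
    congr 1
    simp only [krausMap_apply, Matrix.mul_apply, Matrix.conjTranspose_apply, K,
      Matrix.kroneckerMap_apply, Fintype.sum_prod_type, Matrix.of_apply, Matrix.map_apply,
      inputBlock]
    rw [Finset.sum_eq_single q.1]
    · rw [Finset.mul_sum]
      refine Finset.sum_congr rfl fun a' _ => ?_
      rw [Finset.mul_sum]
      refine Finset.sum_congr rfl fun b' _ => ?_
      rw [Finset.sum_eq_single p.1]
      · rw [← inv_sqrt_mul_inv_sqrt]
        simp only [and_self, if_true, star_mul', Complex.star_def, Complex.conj_ofReal,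
          Finset.sum_mul, Finset.mul_sum]
        refine Finset.sum_congr rfl fun a _ => Finset.sum_congr rfl fun b _ => ?_
        ring
      · intro x _ hx
        simp [hx]
      · exact fun h => absurd (Finset.mem_univ _) h
    · intro x _ hx
      simp [hx]
    · exact fun h => absurd (Finset.mem_univ _) h
  have hU : ∀ k, ((W k).map star ⊗ₖ W k)ᴴ * ((W k).map star ⊗ₖ W k) = 1 := fun k => by
    rw [Matrix.conjTranspose_kronecker, ← Matrix.mul_kronecker_mul, hW,
      map_star_mem_unitaryGroup (Matrix.mem_unitaryGroup_iff'.2 (hW k)), Matrix.one_kronecker_one]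
  rw [hchoi]
  constructor
  · simp only [Matrix.trace_sum, Matrix.trace_smul, trace_krausMap_isometry (hU _)]
    simp
    field_simp
  · simp only [singletFraction_sum, singletFraction_smul, singletFraction_krausMap_unitary (hW _)]
    simp
    field_simp

/-- An operation on the shared matrix that leaves the unknown input alone may be absorbed into that
matrix. -/
lemma telChoi_comp_ampMap {d : ℕ} (T : BiMap (Fin d × Fin d) (Fin d) Unit (Fin d))
    (Λ : BiMap (Fin d) (Fin d) (Fin d) (Fin d))
    (σ : Matrix (Fin d × Fin d) (Fin d × Fin d) ℂ) :
    telChoi (T ∘ₗ ampMap (Fin d) Λ) σ = telChoi T (Λ σ) := by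
  have h : ∀ m n : Fin d, ampMap (Fin d) Λ (inputBlock m n σ) = inputBlock m n (Λ σ) := by
    intro m n
    ext p q
    have e : (inputBlock m n σ).submatrix (fun r => ((p.1.1, r.1), r.2))
        (fun s => ((q.1.1, s.1), s.2)) = if p.1.1 = m ∧ q.1.1 = n then σ else 0 := by
      ext r s
      by_cases h : p.1.1 = m ∧ q.1.1 = n <;> simp [inputBlock, h]
    rw [ampMap_apply, e, inputBlock, Matrix.of_apply]
    split_ifs <;> simp
  ext p q
  simp only [telChoi, Matrix.of_apply, LinearMap.comp_apply, h]

/-! ### Exchange of the parties in the optimal quantities -/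

lemma singletFraction_swapMat {d : ℕ} (σ : Matrix (Fin d × Fin d) (Fin d × Fin d) ℂ) :
    singletFraction (swapMat _ _ σ) = singletFraction σ := by
  simp [singletFraction_eq_sum]

lemma singletFractions_swap (c : Comm) (k : OpKind) {d : ℕ}
    (ρ : Matrix (Fin d × Fin d) (Fin d × Fin d) ℂ) :
    singletFractions c.swap k (swapMat _ _ ρ) = singletFractions c k ρ := by
  have h : ∀ (c : Comm) (ρ : Matrix (Fin d × Fin d) (Fin d × Fin d) ℂ),
      singletFractions c k ρ ⊆ singletFractions c.swap k (swapMat _ _ ρ) := by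
    rintro c ρ _ ⟨Λ, hΛ, htr, rfl⟩
    refine ⟨swapMap Λ, hΛ.swapMap, ?_, ?_⟩
    · simpa [swapMap_apply, trace_swapMat] using htr
    · simp [swapMap_apply, trace_swapMat, singletFraction_swapMat]
  refine Set.Subset.antisymm (fun x hx => ?_) (h c ρ)
  simpa using h c.swap (swapMat _ _ ρ) hx

lemma optSingletFraction_swap (c : Comm) (k : OpKind) {d : ℕ}
    (ρ : Matrix (Fin d × Fin d) (Fin d × Fin d) ℂ) :
    optSingletFraction c.swap k (swapMat _ _ ρ) = optSingletFraction c k ρ := by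
  rw [optSingletFraction, singletFractions_swap, optSingletFraction]

lemma telFidelities_bob (c : Comm) (k : OpKind) {d : ℕ}
    (ρ : Matrix (Fin d × Fin d) (Fin d × Fin d) ℂ) :
    telFidelities c k .bob ρ = telFidelities c.swap k .alice (swapMat _ _ ρ) := by
  ext x
  constructor
  · rintro ⟨T, hT, hp, rfl⟩
    exact ⟨swapMap T, IsLOCC.swapMap hT, hp, rfl⟩
  · rintro ⟨T, hT, hp, rfl⟩
    refine ⟨swapMap T, ?_, hp, rfl⟩
    have h : IsLOCC c.swap.swap k (swapMap T) := IsLOCC.swapMap hT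
    rwa [Comm.swap_swap] at h

/-! ### Positive semidefinite matrices -/

lemma norm_sum_mul_sq_le {ι : Type*} (s : Finset ι) (f g : ι → ℂ) :
    ‖∑ i ∈ s, f i * g i‖ ^ 2 ≤ (∑ i ∈ s, ‖f i‖ ^ 2) * ∑ i ∈ s, ‖g i‖ ^ 2 := by
  calc ‖∑ i ∈ s, f i * g i‖ ^ 2 ≤ (∑ i ∈ s, ‖f i‖ * ‖g i‖) ^ 2 := by
        gcongr
        exact (norm_sum_le _ _).trans (Finset.sum_le_sum fun i _ => (norm_mul _ _).le)
    _ ≤ _ := Finset.sum_mul_sq_le_sq_mul_sq _ _ _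

/-- The projection on a vector, up to normalization. -/
abbrev rankOne {p : Type} (v : p → ℂ) : Matrix p p ℂ := Matrix.vecMulVec v (star v)

/-- The real quadratic form of a matrix. -/
def quad {p : Type} [Fintype p] (v : p → ℂ) (A : Matrix p p ℂ) : ℝ := (star v ⬝ᵥ (A *ᵥ v)).re

lemma singletFraction_eq_quad {d : ℕ} (σ : Matrix (Fin d × Fin d) (Fin d × Fin d) ℂ) :
    singletFraction σ = quad (maxEntVec d) σ := rfl

lemma quad_sum {p ι : Type} [Fintype p] (s : Finset ι) (v : p → ℂ) (A : ι → Matrix p p ℂ) :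
    quad v (∑ i ∈ s, A i) = ∑ i ∈ s, quad v (A i) := by
  simp [quad, Matrix.sum_mulVec, dotProduct_sum]

lemma quad_sub {p : Type} [Fintype p] (v : p → ℂ) (A B : Matrix p p ℂ) :
    quad v (A - B) = quad v A - quad v B := by
  simp [quad, Matrix.sub_mulVec, dotProduct_sub]

lemma quad_smul {p : Type} [Fintype p] (v : p → ℂ) (c : ℝ) (A : Matrix p p ℂ) :
    quad v ((c : ℂ) • A) = c * quad v A := by
  simp [quad, Matrix.smul_mulVec, dotProduct_smul]

lemma re_trace_rankOne {p : Type} [Fintype p] (v : p → ℂ) :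
    (rankOne v).trace.re = ∑ i, ‖v i‖ ^ 2 := by
  simp only [Matrix.trace, Matrix.diag_apply, Matrix.vecMulVec_apply, Complex.re_sum, Pi.star_apply,
    Complex.star_def, Complex.mul_conj, Complex.ofReal_re, Complex.normSq_eq_norm_sq]

lemma quad_rankOne {p : Type} [Fintype p] (v w : p → ℂ) :
    quad w (rankOne v) = ‖∑ i, star (w i) * v i‖ ^ 2 := by
  have h : star w ⬝ᵥ (rankOne v *ᵥ w) = (star w ⬝ᵥ v) * star (star w ⬝ᵥ v) := by
    rw [Matrix.vecMulVec_mulVec]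
    rw [dotProduct_smul, MulOpposite.smul_eq_mul_unop, MulOpposite.unop_op, Matrix.star_dotProduct,
      star_star]
  rw [quad, h, Complex.star_def, Complex.mul_conj, Complex.ofReal_re, Complex.normSq_eq_norm_sq]
  rfl

open scoped MatrixOrder Matrix.Norms.L2Operator in
lemma Matrix.PosSemidef.exists_eq_conjTranspose_mul_self {p : Type} [Fintype p] {A : Matrix p p ℂ}
    (hA : A.PosSemidef) : ∃ B : Matrix p p ℂ, A = Bᴴ * B := by
  classical
  exact CStarAlgebra.nonneg_iff_eq_star_mul_self.mp hA.nonneg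

lemma Matrix.PosSemidef.exists_sum_rankOne {p : Type} [Fintype p] {A : Matrix p p ℂ}
    (hA : A.PosSemidef) : ∃ v : p → p → ℂ, A = ∑ k, rankOne (v k) := by
  obtain ⟨B, rfl⟩ := hA.exists_eq_conjTranspose_mul_self
  refine ⟨fun k i => star (B k i), ?_⟩
  ext i j
  simp [Matrix.mul_apply, Matrix.sum_apply, Matrix.vecMulVec_apply]

lemma posSemidef_rankOne {p : Type} [Fintype p] (v : p → ℂ) : (rankOne v).PosSemidef :=
  Matrix.posSemidef_vecMulVec_self_star v

lemma Matrix.PosSemidef.re_trace_nonneg {p : Type} [Fintype p] {A : Matrix p p ℂ}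
    (hA : A.PosSemidef) : 0 ≤ A.trace.re :=
  (Complex.nonneg_iff.1 hA.trace_nonneg).1

lemma Matrix.PosSemidef.quad_le {p : Type} [Fintype p] {A : Matrix p p ℂ} (hA : A.PosSemidef)
    (w : p → ℂ) : quad w A ≤ A.trace.re * ∑ i, ‖w i‖ ^ 2 := by
  obtain ⟨v, rfl⟩ := hA.exists_sum_rankOne
  rw [quad_sum, Matrix.trace_sum, Complex.re_sum, Finset.sum_mul]
  refine Finset.sum_le_sum fun k _ => ?_
  rw [quad_rankOne, re_trace_rankOne, mul_comm]
  refine (norm_sum_mul_sq_le _ _ _).trans ?_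
  simp

lemma posSemidef_of_quad_nonneg {p : Type} [Fintype p] {A : Matrix p p ℂ} (hA : A.IsHermitian)
    (h : ∀ v, 0 ≤ quad v A) : A.PosSemidef := by
  refine Matrix.PosSemidef.of_dotProduct_mulVec_nonneg hA fun v => ?_
  rw [Complex.nonneg_iff]
  exact ⟨h v, (hA.im_star_dotProduct_mulVec_self v).symm⟩

lemma quad_one {p : Type} [Fintype p] [DecidableEq p] (w : p → ℂ) :
    quad w 1 = ∑ i, ‖w i‖ ^ 2 := by
  rw [quad, Matrix.one_mulVec, ← re_trace_rankOne, Matrix.trace_vecMulVec, dotProduct_comm]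

lemma Matrix.PosSemidef.le_trace {p : Type} [Fintype p] [DecidableEq p] {A : Matrix p p ℂ}
    (hA : A.PosSemidef) (htr : A.trace = 1) : (1 - A).PosSemidef := by
  refine posSemidef_of_quad_nonneg (Matrix.isHermitian_one.sub hA.1) fun v => ?_
  have h := hA.quad_le v
  rw [htr] at h
  rw [quad_sub, quad_one]
  simp at h
  linarith

/-- Cauchy–Schwarz for the form of `A`: `|⟨v, A χ⟩|² ≤ ⟨v, A v⟩ ⟨χ, A χ⟩`. So every vector of the
range can be split off with a positive weight. -/
lemma exists_smul_rankOne_le {p : Type} [Fintype p] {A : Matrix p p ℂ} (hA : A.PosSemidef)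
    (χ : p → ℂ) : ∃ c : ℝ, 0 < c ∧ (A - (c : ℂ) • rankOne (A *ᵥ χ)).PosSemidef := by
  obtain ⟨B, hB⟩ := hA.exists_eq_conjTranspose_mul_self
  have hq : ∀ v, quad v A = ∑ k, ‖(B *ᵥ v) k‖ ^ 2 := fun v => by
    rw [quad, hB, ← Matrix.mulVec_mulVec, Matrix.dotProduct_mulVec, Matrix.vecMul_conjTranspose,
      star_star, ← re_trace_rankOne, Matrix.trace_vecMulVec, dotProduct_comm]
  have hχ : 0 ≤ quad χ A := by
    rw [hq]
    positivity
  -- The added `1` covers the case `⟨χ, A χ⟩ = 0`.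
  refine ⟨1 / (quad χ A + 1), by positivity, posSemidef_of_quad_nonneg ?_ fun v => ?_⟩
  · refine hA.1.sub ?_
    rw [Matrix.IsHermitian, Matrix.conjTranspose_smul, (posSemidef_rankOne (A *ᵥ χ)).1]
    simp
  · have h1 : ∑ i, star (v i) * (A *ᵥ χ) i = ∑ k, star ((B *ᵥ v) k) * (B *ᵥ χ) k := by
      change star v ⬝ᵥ (A *ᵥ χ) = star (B *ᵥ v) ⬝ᵥ (B *ᵥ χ)
      rw [hB, ← Matrix.mulVec_mulVec, Matrix.dotProduct_mulVec, Matrix.vecMul_conjTranspose,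
        star_star]
    have h2 : ‖∑ i, star (v i) * (A *ᵥ χ) i‖ ^ 2 ≤ quad v A * quad χ A := by
      rw [h1, hq, hq]
      refine (norm_sum_mul_sq_le _ _ _).trans ?_
      simp
    have hv : 0 ≤ quad v A := by
      rw [hq]
      positivity
    rw [quad_sub, quad_smul, quad_rankOne, sub_nonneg, div_mul_eq_mul_div, one_mul,
      div_le_iff₀ (by positivity)]
    nlinarith

lemma krausMap_rankOne {p q : Type} [Fintype p] (K : Matrix q p ℂ) (v : p → ℂ) :
    krausMap K (rankOne v) = rankOne (K *ᵥ v) := by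
  rw [krausMap_apply, Matrix.mul_vecMulVec, Matrix.vecMulVec_mul, Matrix.vecMul_conjTranspose,
    star_star]

lemma IsSeparableMap.posSemidef {a b a' b' : Type} [Fintype a] [Fintype b] [Fintype a']
    [Fintype b'] {Λ : BiMap a b a' b'} (hΛ : IsSeparableMap Λ) {X : Matrix (a × b) (a × b) ℂ}
    (hX : X.PosSemidef) : (Λ X).PosSemidef := by
  obtain ⟨n, A, B, rfl⟩ := hΛ
  rw [LinearMap.sum_apply]
  exact Matrix.posSemidef_sum _ fun i _ => hX.mul_mul_conjTranspose_same _

/-! ### The weight outside the maximally entangled vector -/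

lemma sum_norm_maxEntVec {d : ℕ} [NeZero d] : ∑ p, ‖maxEntVec d p‖ ^ 2 = 1 := by
  have hd : (d : ℝ) ≠ 0 := Nat.cast_ne_zero.2 (NeZero.ne d)
  rw [Fintype.sum_prod_type]
  have h : ∀ x y : Fin d, ‖maxEntVec d (x, y)‖ ^ 2 = if x = y then (1 / d : ℝ) else 0 := by
    intro x y
    by_cases hxy : x = y
    · simp [maxEntVec, hxy]
    · simp [maxEntVec, hxy]
  simp only [h]
  simp [hd]

/-- The weight `Tr (1 - |Ψ₊⟩⟨Ψ₊|) σ`. -/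
def deficit {d : ℕ} (σ : Matrix (Fin d × Fin d) (Fin d × Fin d) ℂ) : ℝ :=
  σ.trace.re - singletFraction σ

lemma deficit_nonneg {d : ℕ} [NeZero d] {σ : Matrix (Fin d × Fin d) (Fin d × Fin d) ℂ}
    (hσ : σ.PosSemidef) : 0 ≤ deficit σ := by
  have h := hσ.quad_le (maxEntVec d)
  rw [sum_norm_maxEntVec, mul_one, ← singletFraction_eq_quad] at h
  exact sub_nonneg.2 h

lemma deficit_sum {d : ℕ} {ι : Type*} (s : Finset ι)
    (σ : ι → Matrix (Fin d × Fin d) (Fin d × Fin d) ℂ) :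
    deficit (∑ i ∈ s, σ i) = ∑ i ∈ s, deficit (σ i) := by
  simp [deficit, singletFraction_sum, Matrix.trace_sum, Finset.sum_sub_distrib]

lemma deficit_smul {d : ℕ} (c : ℝ) (σ : Matrix (Fin d × Fin d) (Fin d × Fin d) ℂ) :
    deficit ((c : ℂ) • σ) = c * deficit σ := by
  rw [deficit, deficit, singletFraction_smul, Matrix.trace_smul, smul_eq_mul,
    Complex.re_ofReal_mul, mul_sub]

lemma smul_deficit_le {a b : Type} [Fintype a] [Fintype b] {d : ℕ} [NeZero d]
    {Λ : BiMap a b (Fin d) (Fin d)} (hΛ : IsSeparableMap Λ) {X Y : Matrix (a × b) (a × b) ℂ} {c : ℝ}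
    (h : (X - (c : ℂ) • Y).PosSemidef) : c * deficit (Λ Y) ≤ deficit (Λ X) := by
  have h1 := deficit_nonneg (hΛ.posSemidef h)
  have h2 : deficit (Λ (X - (c : ℂ) • Y) + (c : ℂ) • Λ Y) =
      deficit (Λ (X - (c : ℂ) • Y)) + deficit ((c : ℂ) • Λ Y) := by
    simp only [deficit, singletFraction_add, Matrix.trace_add, Complex.add_re]
    ring
  rw [deficit_smul, ← map_smul, ← map_add, sub_add_cancel] at h2
  linarith

/-- The reduced matrix of Alice. -/
def margA {a b : Type} [Fintype b] (σ : Matrix (a × b) (a × b) ℂ) : Matrix a a ℂ :=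
  ∑ y, σ.submatrix (fun x => (x, y)) fun x => (x, y)

lemma margA_sum {a b ι : Type} [Fintype b] (s : Finset ι) (σ : ι → Matrix (a × b) (a × b) ℂ) :
    margA (∑ i ∈ s, σ i) = ∑ i ∈ s, margA (σ i) := by
  ext x x'
  simp only [margA, Matrix.sum_apply, Matrix.submatrix_apply]
  exact Finset.sum_comm

lemma Matrix.PosSemidef.margA {a b : Type} [Fintype a] [Fintype b]
    {σ : Matrix (a × b) (a × b) ℂ} (hσ : σ.PosSemidef) : (margA σ).PosSemidef :=
  Matrix.posSemidef_sum _ fun _ _ => hσ.submatrix _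

lemma trace_margA {a b : Type} [Fintype a] [Fintype b] (σ : Matrix (a × b) (a × b) ℂ) :
    (margA σ).trace = σ.trace := by
  simp only [Matrix.trace, margA, Matrix.diag_apply, Matrix.sum_apply, Matrix.submatrix_apply,
    Fintype.sum_prod_type]

lemma quad_margA_rankOne {a b : Type} [Fintype a] [Fintype b] (u : a → ℂ) (v : a × b → ℂ) :
    quad u (margA (rankOne v)) = ∑ y, ‖∑ x, star (u x) * v (x, y)‖ ^ 2 := by
  rw [margA, quad_sum]
  refine Finset.sum_congr rfl fun y _ => ?_
  rw [← quad_rankOne (fun x => v (x, y)) u]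
  rfl

/-- The sum on the left is the trace of the coefficient matrix. The part of it seen by `P = 1 -
|u⟩⟨u|` is bounded by Cauchy–Schwarz with the Hilbert–Schmidt norm `‖P‖² = d - 1`, which gains over
the trivial bound `d`; the rest is controlled by the reduced matrix in direction `u`. -/
lemma norm_sum_diag_sq_le {d : ℕ} [NeZero d] {u : Fin d → ℂ} (hu : ∑ i, ‖u i‖ ^ 2 = 1)
    (v : Fin d × Fin d → ℂ) :
    ‖∑ x, v (x, x)‖ ^ 2 ≤ (d - 1 / d) * (∑ p, ‖v p‖ ^ 2) +
      (d + 1) * ∑ y, ‖∑ x, star (u x) * v (x, y)‖ ^ 2 := by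
  have hd : (0 : ℝ) < d := Nat.cast_pos.2 (NeZero.pos d)
  have hu' : star u ⬝ᵥ u = 1 := by
    have : star u ⬝ᵥ u = ((∑ i, ‖u i‖ ^ 2 : ℝ) : ℂ) := by
      simp [dotProduct, ← Complex.normSq_eq_conj_mul_self, Complex.normSq_eq_norm_sq]
    rw [this, hu, Complex.ofReal_one]
  set P : Matrix (Fin d) (Fin d) ℂ := 1 - rankOne u with hP
  have hPH : Pᴴ = P := by
    rw [hP, Matrix.conjTranspose_sub, (posSemidef_rankOne u).1, Matrix.conjTranspose_one]
  have hPP : P * P = P := by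
    have : rankOne u * rankOne u = rankOne u := by
      rw [Matrix.vecMulVec_mul_vecMulVec, hu', one_smul]
    rw [hP, sub_mul, mul_sub, mul_sub, this]
    simp
  have hPn : ∑ x, ∑ y, ‖P x y‖ ^ 2 = d - 1 := by
    have h1 : (Pᴴ * P).trace.re = ∑ x, ∑ y, ‖P x y‖ ^ 2 := by
      rw [Finset.sum_comm]
      simp [Matrix.trace, Matrix.mul_apply, ← Complex.normSq_eq_conj_mul_self,
        Complex.normSq_eq_norm_sq, -Complex.ofReal_pow]
    rw [← h1, hPH, hPP, hP, Matrix.trace_sub, Complex.sub_re, re_trace_rankOne, hu]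
    simp
  have hsplit : ∑ x, v (x, x) = (∑ p : Fin d × Fin d, P p.2 p.1 * v p) +
      ∑ y, (∑ x, star (u x) * v (x, y)) * u y := by
    simp only [Fintype.sum_prod_type, hP, Matrix.sub_apply, sub_mul, Finset.sum_sub_distrib,
      Matrix.vecMulVec_apply, Matrix.one_apply, Finset.sum_mul]
    rw [Finset.sum_comm (f := fun y x => star (u x) * v (x, y) * u y)]
    simp only [ite_mul, one_mul, zero_mul, Finset.sum_ite_eq', Finset.mem_univ,
      if_true, Pi.star_apply]
    symm
    rw [sub_add, sub_eq_self, sub_eq_zero]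
    refine Finset.sum_congr rfl fun x _ => Finset.sum_congr rfl fun y _ => ?_
    ring
  have ha : ‖∑ p : Fin d × Fin d, P p.2 p.1 * v p‖ ^ 2 ≤ (d - 1) * ∑ p, ‖v p‖ ^ 2 := by
    refine (norm_sum_mul_sq_le _ _ _).trans (le_of_eq ?_)
    rw [← hPn, Fintype.sum_prod_type, Finset.sum_comm]
  have hb : ‖∑ y, (∑ x, star (u x) * v (x, y)) * u y‖ ^ 2 ≤
      ∑ y, ‖∑ x, star (u x) * v (x, y)‖ ^ 2 := by
    refine (norm_sum_mul_sq_le _ _ _).trans (le_of_eq ?_)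
    rw [hu, mul_one]
  rw [hsplit]
  generalize (∑ p : Fin d × Fin d, P p.2 p.1 * v p) = z at ha
  generalize (∑ y, (∑ x, star (u x) * v (x, y)) * u y) = w at hb
  have h1 : ‖z + w‖ ^ 2 ≤ (‖z‖ + ‖w‖) ^ 2 := by
    gcongr
    exact norm_add_le _ _
  -- The weight `1 / d` in `2 ‖z‖ ‖w‖ ≤ ‖z‖² / d + d ‖w‖²` is small enough to leave `(1 + 1/d)(d -
  -- 1) = d - 1/d < d`.
  have h2 : (‖z‖ + ‖w‖) ^ 2 ≤ (1 + 1 / d) * ‖z‖ ^ 2 + (d + 1) * ‖w‖ ^ 2 := by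
    have h3 : 0 ≤ (‖z‖ - d * ‖w‖) ^ 2 / d := by positivity
    have h4 : (‖z‖ - d * ‖w‖) ^ 2 / d = 1 / d * ‖z‖ ^ 2 - 2 * ‖z‖ * ‖w‖ + d * ‖w‖ ^ 2 := by
      field_simp
      ring
    nlinarith
  have h5 : (1 + 1 / d : ℝ) * ‖z‖ ^ 2 ≤ (1 + 1 / d) * ((d - 1) * ∑ p, ‖v p‖ ^ 2) := by gcongr
  have h6 : (d + 1 : ℝ) * ‖w‖ ^ 2 ≤ (d + 1) * ∑ y, ‖∑ x, star (u x) * v (x, y)‖ ^ 2 := by gcongr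
  have h7 : (1 + 1 / d : ℝ) * ((d - 1) * ∑ p, ‖v p‖ ^ 2) = (d - 1 / d) * ∑ p, ‖v p‖ ^ 2 := by
    field_simp
    ring
  linarith

lemma singletFraction_rankOne {d : ℕ} (v : Fin d × Fin d → ℂ) :
    singletFraction (rankOne v) = ‖∑ x, v (x, x)‖ ^ 2 / d := by
  have h : ∑ x, ∑ y, rankOne v (x, x) (y, y) =
      (∑ x, v (x, x)) * star (∑ x, v (x, x)) := by
    simp [Matrix.vecMulVec_apply, Finset.sum_mul_sum]
  rw [singletFraction_eq_sum, h, Complex.star_def, Complex.mul_conj, Complex.ofReal_re,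
    Complex.normSq_eq_norm_sq]

/-- The maximally entangled vector has little weight on matrices whose reduced matrix has a small
expectation in some direction. -/
lemma le_deficit {d : ℕ} [NeZero d] {u : Fin d → ℂ} (hu : ∑ i, ‖u i‖ ^ 2 = 1)
    {σ : Matrix (Fin d × Fin d) (Fin d × Fin d) ℂ} (hσ : σ.PosSemidef) :
    1 / (d : ℝ) ^ 2 * σ.trace.re - 2 * quad u (margA σ) ≤ deficit σ := by
  have hd : (1 : ℝ) ≤ d := by exact_mod_cast NeZero.one_le
  obtain ⟨v, rfl⟩ := hσ.exists_sum_rankOne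
  rw [deficit_sum, margA_sum, quad_sum, Matrix.trace_sum, Complex.re_sum, Finset.mul_sum,
    Finset.mul_sum, ← Finset.sum_sub_distrib]
  refine Finset.sum_le_sum fun k _ => ?_
  rw [deficit, re_trace_rankOne, quad_margA_rankOne, singletFraction_rankOne]
  have h := norm_sum_diag_sq_le hu (v k)
  have hnn : 0 ≤ ∑ y, ‖∑ x, star (u x) * v k (x, y)‖ ^ 2 := by positivity
  generalize ∑ y, ‖∑ x, star (u x) * v k (x, y)‖ ^ 2 = q at *
  generalize ∑ p, ‖v k p‖ ^ 2 = t at *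
  have h1 : ‖∑ x, v k (x, x)‖ ^ 2 / d ≤ ((d - 1 / d) * t + (d + 1) * q) / d := by gcongr
  have h2 : ((d - 1 / d) * t + (d + 1) * q) / d = t - 1 / (d : ℝ) ^ 2 * t + (d + 1) / d * q := by
    field_simp
  have h3 : (d + 1 : ℝ) / d * q ≤ 2 * q := by
    gcongr
    rw [div_le_iff₀ (by linarith)]
    linarith
  linarith

/-! ### Vectors of deficient Schmidt rank -/

/-- The coefficient matrix of a bipartite vector. -/
def coeffMat {d : ℕ} (v : Fin d × Fin d → ℂ) : Matrix (Fin d) (Fin d) ℂ :=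
  Matrix.of fun i j => v (i, j)

lemma coeffMat_kronecker_mulVec {d : ℕ} (A B : Matrix (Fin d) (Fin d) ℂ)
    (v : Fin d × Fin d → ℂ) : coeffMat ((A ⊗ₖ B) *ᵥ v) = A * coeffMat v * Bᵀ := by
  ext i j
  simp only [coeffMat, Matrix.of_apply, Matrix.mulVec, dotProduct, Fintype.sum_prod_type,
    Matrix.kroneckerMap_apply, Matrix.mul_apply, Matrix.transpose_apply, Finset.sum_mul]
  rw [Finset.sum_comm]
  refine Finset.sum_congr rfl fun x _ => Finset.sum_congr rfl fun y _ => ?_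
  ring

lemma sum_norm_sq_pos {p : Type} [Fintype p] {v : p → ℂ} (hv : v ≠ 0) : 0 < ∑ i, ‖v i‖ ^ 2 := by
  obtain ⟨i, hi⟩ := Function.ne_iff.1 hv
  exact Finset.sum_pos' (fun _ _ => by positivity)
    ⟨i, Finset.mem_univ _, pow_pos (norm_pos_iff.2 hi) 2⟩

lemma exists_smul_unit {p : Type} [Fintype p] {v : p → ℂ} (hv : v ≠ 0) :
    ∃ c : ℂ, ∑ i, ‖(c • v) i‖ ^ 2 = 1 := by
  have h := sum_norm_sq_pos hv
  refine ⟨((Real.sqrt (∑ i, ‖v i‖ ^ 2))⁻¹ : ℝ), ?_⟩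
  simp only [Pi.smul_apply, norm_smul, mul_pow, ← Finset.mul_sum]
  rw [Complex.norm_real, Real.norm_eq_abs, sq_abs, inv_pow, Real.sq_sqrt h.le,
    inv_mul_cancel₀ h.ne']

/-- The conjugate of a left null vector of the coefficient matrix is a direction in which Alice's
reduced matrix vanishes. -/
lemma le_deficit_rankOne_of_det_eq_zero {d : ℕ} [NeZero d] {v : Fin d × Fin d → ℂ}
    (hv : (coeffMat v).det = 0) :
    1 / (d : ℝ) ^ 2 * (rankOne v).trace.re ≤ deficit (rankOne v) := by
  obtain ⟨w, hw0, hw⟩ := Matrix.exists_vecMul_eq_zero_iff.2 hv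
  obtain ⟨c, hc⟩ := exists_smul_unit hw0
  have hu : ∑ i, ‖(star (c • w)) i‖ ^ 2 = 1 := by
    simpa using hc
  have h := le_deficit hu (posSemidef_rankOne v)
  have hq : quad (star (c • w)) (margA (rankOne v)) = 0 := by
    rw [quad_margA_rankOne]
    refine Finset.sum_eq_zero fun y _ => ?_
    have h0 := congrFun hw y
    have h1 : ∑ x, star ((star (c • w)) x) * v (x, y) = c * (w ᵥ* coeffMat v) y := by
      simp only [Matrix.vecMul, dotProduct, coeffMat, Matrix.of_apply, Finset.mul_sum,
        Pi.star_apply, star_star, Pi.smul_apply, smul_eq_mul, mul_assoc]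
    rw [h1, h0]
    simp
  rwa [hq, mul_zero, sub_zero] at h

lemma IsSeparableMap.le_deficit {d : ℕ} [NeZero d] {Λ : BiMap (Fin d) (Fin d) (Fin d) (Fin d)}
    (hΛ : IsSeparableMap Λ) {v : Fin d × Fin d → ℂ} (hv : (coeffMat v).det = 0) :
    1 / (d : ℝ) ^ 2 * (Λ (rankOne v)).trace.re ≤ deficit (Λ (rankOne v)) := by
  obtain ⟨n, A, B, rfl⟩ := hΛ
  rw [LinearMap.sum_apply, Matrix.trace_sum, Complex.re_sum, Finset.mul_sum, deficit_sum]
  refine Finset.sum_le_sum fun i _ => ?_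
  rw [krausMap_rankOne]
  refine le_deficit_rankOne_of_det_eq_zero ?_
  rw [coeffMat_kronecker_mulVec, Matrix.det_mul, Matrix.det_mul, hv, mul_zero, zero_mul]

/-- If all vectors in the range of a density matrix are proportional, it is a pure state. -/
lemma not_isStrictlyMixed_of_range {p : Type} [Fintype p] {ρ : Matrix p p ℂ} (hρ : IsState ρ)
    {φ : p → ℂ} (h : ∀ χ, ∃ c : ℂ, ρ *ᵥ χ = c • φ) : ¬ IsStrictlyMixed ρ := by
  classical
  choose c hc using fun j => h (Pi.single j 1)
  have hent : ∀ i j, ρ i j = c j * φ i := fun i j => by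
    have := congrFun (hc j) i
    simpa [Matrix.mulVec_single] using this
  have hφ : φ ≠ 0 := by
    rintro rfl
    have : ρ = 0 := by
      ext i j
      simp [hent]
    have h1 := hρ.2
    simp [this] at h1
  obtain ⟨k, hk⟩ := Function.ne_iff.1 hφ
  have hk' : φ k ≠ 0 := hk
  have hherm : ∀ i j, star (ρ j i) = ρ i j := fun i j => hρ.1.1.apply i j
  -- Hermitian symmetry at the positions `(k, j)` and `(j, k)`, with `φ k ≠ 0`, makes `c`
  -- proportional to the conjugate of `φ`; the trace then fixes the factor.
  obtain ⟨κ, hκ⟩ : ∃ κ : ℂ, ∀ j, c j = κ * star (φ j) := by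
    refine ⟨star (c k) / φ k, fun j => ?_⟩
    have h1 := hherm k j
    rw [hent, hent, star_mul'] at h1
    field_simp
    rw [← h1, mul_comm]
  have hs := sum_norm_sq_pos hφ
  have htr : κ * ((∑ i, ‖φ i‖ ^ 2 : ℝ) : ℂ) = 1 := by
    rw [← hρ.2, Matrix.trace, Complex.ofReal_sum, Finset.mul_sum]
    refine Finset.sum_congr rfl fun i _ => ?_
    rw [Matrix.diag_apply, hent, hκ, mul_assoc, Complex.star_def,
      ← Complex.normSq_eq_conj_mul_self, Complex.normSq_eq_norm_sq]
  have hκ' : κ = (((∑ i, ‖φ i‖ ^ 2)⁻¹ : ℝ) : ℂ) := by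
    rw [Complex.ofReal_inv]
    exact eq_inv_of_mul_eq_one_left htr
  intro hmix
  refine hmix (((Real.sqrt ((∑ i, ‖φ i‖ ^ 2)⁻¹) : ℝ) : ℂ) • φ) ?_
  ext i j
  have hsq : ((Real.sqrt ((∑ i, ‖φ i‖ ^ 2)⁻¹) : ℝ) : ℂ) *
      ((Real.sqrt ((∑ i, ‖φ i‖ ^ 2)⁻¹) : ℝ) : ℂ) = κ := by
    rw [← Complex.ofReal_mul, Real.mul_self_sqrt (by positivity), hκ']
  rw [hent, hκ, ← hsq]
  simp only [Matrix.vecMulVec_apply, Pi.smul_apply, Pi.star_apply, smul_eq_mul, star_mul',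
    Complex.star_def, Complex.conj_ofReal]
  ring

lemma coeffMat_sub_smul {d : ℕ} (v w : Fin d × Fin d → ℂ) (c : ℂ) :
    coeffMat (v - c • w) = coeffMat v - c • coeffMat w := rfl

/-- The range of a strictly mixed state contains a vector of deficient Schmidt rank. -/
lemma exists_det_eq_zero_of_isStrictlyMixed {d : ℕ} [NeZero d]
    {ρ : Matrix (Fin d × Fin d) (Fin d × Fin d) ℂ} (hρ : IsState ρ) (hmix : IsStrictlyMixed ρ) :
    ∃ χ, ρ *ᵥ χ ≠ 0 ∧ (coeffMat (ρ *ᵥ χ)).det = 0 := by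
  have hρ0 : ∃ χ₂, ρ *ᵥ χ₂ ≠ 0 := by
    by_contra! h
    exact not_isStrictlyMixed_of_range hρ (φ := 0) (fun χ => ⟨0, by simp [h]⟩) hmix
  obtain ⟨χ₂, h₂⟩ := hρ0
  by_cases hdet : (coeffMat (ρ *ᵥ χ₂)).det = 0
  · exact ⟨χ₂, h₂, hdet⟩
  obtain ⟨χ₁, h₁⟩ : ∃ χ₁, ∀ c : ℂ, ρ *ᵥ χ₁ ≠ c • (ρ *ᵥ χ₂) := by
    by_contra! h
    exact not_isStrictlyMixed_of_range hρ h hmix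
  set M₁ := coeffMat (ρ *ᵥ χ₁)
  set M₂ := coeffMat (ρ *ᵥ χ₂)
  -- For an eigenvalue `z` of `M₂⁻¹ M₁` the matrix `M₁ - z M₂` is singular; its vector is nonzero
  -- because the two range vectors are not proportional.
  obtain ⟨z, hz⟩ := IsAlgClosed.exists_root (M₂⁻¹ * M₁).charpoly (by
    rw [Matrix.charpoly_degree_eq_dim]
    simpa using NeZero.ne d)
  rw [Polynomial.IsRoot, Matrix.eval_charpoly] at hz
  refine ⟨χ₁ - z • χ₂, fun h => h₁ z ?_, ?_⟩
  · rw [Matrix.mulVec_sub, Matrix.mulVec_smul] at h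
    exact sub_eq_zero.1 h
  · have hunit : IsUnit M₂.det := isUnit_iff_ne_zero.2 hdet
    rw [Matrix.mulVec_sub, Matrix.mulVec_smul, coeffMat_sub_smul]
    have e : M₁ - z • M₂ = -(M₂ * (Matrix.scalar (Fin d) z - M₂⁻¹ * M₁)) := by
      rw [Matrix.mul_sub, ← Matrix.mul_assoc, Matrix.mul_nonsing_inv _ hunit, Matrix.one_mul,
        neg_sub]
      congr 1
      ext i j
      simp [mul_comm]
    change (M₁ - z • M₂).det = 0
    rw [e, Matrix.det_neg, Matrix.det_mul, hz, mul_zero, mul_zero]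

/-! ### Thresholds for the singlet fraction -/

/-- The singlet fractions that operations of a class produce from `ρ` are bounded away from one. -/
def HasGap (c : Comm) (k : OpKind) {d : ℕ} (ρ : Matrix (Fin d × Fin d) (Fin d × Fin d) ℂ) : Prop :=
  ∃ δ : ℝ, 0 < δ ∧ ∀ Λ : BiMap (Fin d) (Fin d) (Fin d) (Fin d), IsLOCC c k Λ →
    δ * (Λ ρ).trace.re ≤ deficit (Λ ρ)

lemma hasGap_tracePreserving {d : ℕ} [NeZero d] {ρ : Matrix (Fin d × Fin d) (Fin d × Fin d) ℂ}
    (hρ : IsState ρ) (hmix : IsStrictlyMixed ρ) (c : Comm) : HasGap c .tracePreserving ρ := by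
  obtain ⟨χ, h0, hdet⟩ := exists_det_eq_zero_of_isStrictlyMixed hρ hmix
  obtain ⟨r, hr, hle⟩ := exists_smul_rankOne_le hρ.1 χ
  have hd : (0 : ℝ) < d := Nat.cast_pos.2 (NeZero.pos d)
  have hs := sum_norm_sq_pos h0
  refine ⟨r * (1 / (d : ℝ) ^ 2 * ∑ i, ‖(ρ *ᵥ χ) i‖ ^ 2), by positivity, fun Λ hΛ => ?_⟩
  have h1 := smul_deficit_le hΛ.isSeparableMap hle
  have h2 := hΛ.isSeparableMap.le_deficit hdet
  rw [hΛ.trace_eq, re_trace_rankOne] at h2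
  rw [hΛ.trace_eq, hρ.2, Complex.one_re, mul_one]
  exact (mul_le_mul_of_nonneg_left h2 hr.le).trans h1

lemma two_le_of_isStrictlyMixed {d : ℕ} [NeZero d] {ρ : Matrix (Fin d × Fin d) (Fin d × Fin d) ℂ}
    (hρ : IsState ρ) (hmix : IsStrictlyMixed ρ) : 2 ≤ d := by
  by_contra h
  have hd : d = 1 := by
    have := NeZero.pos d
    omega
  subst hd
  refine not_isStrictlyMixed_of_range hρ (φ := fun _ => 1) (fun χ => ⟨(ρ *ᵥ χ) (0, 0), ?_⟩) hmix
  ext i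
  rw [Subsingleton.elim i (0, 0)]
  simp

/-- An invertible `ρ` has all standard basis vectors in its range. They are product vectors, hence
of singular coefficient matrix once `d ≥ 2`, and each is split off with weight at least `r q`. -/
lemma hasGap_posDef {d : ℕ} [NeZero d] {ρ : Matrix (Fin d × Fin d) (Fin d × Fin d) ℂ}
    (hρ : IsState ρ) (hmix : IsStrictlyMixed ρ) (hpos : ρ.PosDef) (c : Comm) (k : OpKind) :
    HasGap c k ρ := by
  have hd2 := two_le_of_isStrictlyMixed hρ hmix
  have hd : (0 : ℝ) < d := Nat.cast_pos.2 (NeZero.pos d)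
  have hunit : IsUnit ρ.det := (Matrix.isUnit_iff_isUnit_det _).1 hpos.isUnit
  let e : Fin d × Fin d → Fin d × Fin d → ℂ := fun p => Pi.single p 1
  have hr : ∀ p, ∃ r : ℝ, 0 < r ∧ (ρ - (r : ℂ) • rankOne (e p)).PosSemidef := fun p => by
    have h := exists_smul_rankOne_le hρ.1 (ρ⁻¹ *ᵥ e p)
    rwa [Matrix.mulVec_mulVec, Matrix.mul_nonsing_inv _ hunit, Matrix.one_mulVec] at h
  choose r hr0 hr using hr
  obtain ⟨q, -, hq⟩ := Finset.exists_min_image Finset.univ r Finset.univ_nonempty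
  have hdet : ∀ p, (coeffMat (e p)).det = 0 := fun p => by
    have : Nontrivial (Fin d) := Fin.nontrivial_iff_two_le.2 hd2
    obtain ⟨i, hi⟩ := exists_ne p.1
    refine Matrix.det_eq_zero_of_row_eq_zero i fun j => ?_
    simp [coeffMat, e, Pi.single_apply, Prod.ext_iff, hi]
  have hone : ∑ p, rankOne (e p) = 1 := by
    ext i j
    simp [Matrix.sum_apply, Matrix.vecMulVec_apply, e, Pi.single_apply, Matrix.one_apply,
      apply_ite (starRingEnd ℂ)]
  refine ⟨r q * (1 / (d : ℝ) ^ 2) / (d : ℝ) ^ 2, by have := hr0 q; positivity, fun Λ hΛ => ?_⟩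
  have hsep := hΛ.isSeparableMap
  have h1 : ∀ p, r q * (1 / (d : ℝ) ^ 2 * (Λ (rankOne (e p))).trace.re) ≤ deficit (Λ ρ) := fun p => by
    have h2 := hsep.le_deficit (hdet p)
    have h3 : 0 ≤ (Λ (rankOne (e p))).trace.re :=
      (hsep.posSemidef (posSemidef_rankOne _)).re_trace_nonneg
    calc _ ≤ r p * (1 / (d : ℝ) ^ 2 * (Λ (rankOne (e p))).trace.re) := by
          gcongr
          exact hq p (Finset.mem_univ _)
      _ ≤ r p * deficit (Λ (rankOne (e p))) := by
          gcongr
          exact (hr0 p).le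
      _ ≤ _ := smul_deficit_le hsep (hr p)
  have h4 := Finset.sum_le_sum fun p (_ : p ∈ Finset.univ) => h1 p
  rw [← Finset.mul_sum, ← Finset.mul_sum, ← Complex.re_sum, ← Matrix.trace_sum, ← map_sum, hone,
    Finset.sum_const, nsmul_eq_mul, Finset.card_univ, Fintype.card_prod, Fintype.card_fin] at h4
  -- Since `ρ` has trace one, `ρ ≤ 1`. The success probability on `1` bounds that on `ρ`, and it is
  -- the sum of those on the basis vectors.
  have h5 : (Λ ρ).trace.re ≤ (Λ 1).trace.re := by
    have := (hsep.posSemidef (hρ.1.le_trace hρ.2)).re_trace_nonneg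
    rw [map_sub, Matrix.trace_sub, Complex.sub_re] at this
    linarith
  have h6 : r q * (1 / (d : ℝ) ^ 2 * (Λ ρ).trace.re) ≤ r q * (1 / (d : ℝ) ^ 2 * (Λ 1).trace.re) := by
    have := (hr0 q).le
    gcongr
  push_cast at h4
  rw [div_mul_eq_mul_div, div_le_iff₀ (by positivity)]
  nlinarith

/-! ### One-way communication -/

/-- No signalling: a trace-preserving channel of Bob does not affect Alice's reduced matrix. This is
where one-way communication enters the threshold. -/
lemma margA_sum_krausMap {a b a' b' ι : Type} [Fintype a] [Fintype b] [Fintype b'] [DecidableEq b]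
    [Fintype ι] (K : Matrix a' a ℂ) (L : ι → Matrix b' b ℂ) (hL : ∑ j, (L j)ᴴ * L j = 1)
    (X : Matrix (a × b) (a × b) ℂ) :
    margA (∑ j, krausMap (K ⊗ₖ L j) X) = krausMap K (margA X) := by
  have hL' : ∀ s t, ∑ y, ∑ j, L j y s * star (L j y t) = if s = t then 1 else 0 := fun s t => by
    have h := congrFun (congrFun hL t) s
    simp only [Matrix.sum_apply, Matrix.mul_apply, Matrix.conjTranspose_apply,
      Matrix.one_apply] at h
    rw [Finset.sum_comm]
    simp only [mul_comm (L _ _ _)]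
    rw [h]
    simp [eq_comm]
  ext x x'
  have h1 : margA (∑ j, krausMap (K ⊗ₖ L j) X) x x' =
      ∑ q' : a, ∑ t : b, ∑ q : a, ∑ s : b, K x q * X (q, s) (q', t) * star (K x' q') *
        ∑ y, ∑ j, L j y s * star (L j y t) := by
    simp only [margA, Matrix.sum_apply, Matrix.submatrix_apply, krausMap_apply, Matrix.mul_apply,
      Matrix.conjTranspose_apply, Matrix.kroneckerMap_apply, Fintype.sum_prod_type, Finset.sum_mul,
      Finset.mul_sum, star_mul']
    rw [Finset.sum_congr rfl fun y _ => Finset.sum_comm, Finset.sum_comm]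
    refine Finset.sum_congr rfl fun q' _ => ?_
    rw [Finset.sum_congr rfl fun y _ => Finset.sum_comm, Finset.sum_comm]
    refine Finset.sum_congr rfl fun t _ => ?_
    rw [Finset.sum_congr rfl fun y _ => Finset.sum_comm, Finset.sum_comm]
    refine Finset.sum_congr rfl fun q _ => ?_
    rw [Finset.sum_congr rfl fun y _ => Finset.sum_comm, Finset.sum_comm]
    refine Finset.sum_congr rfl fun s _ => Finset.sum_congr rfl fun y _ =>
      Finset.sum_congr rfl fun j _ => ?_
    ring
  rw [h1]
  simp only [hL', krausMap_apply, Matrix.mul_apply, Matrix.conjTranspose_apply, margA,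
    Matrix.sum_apply, Matrix.submatrix_apply, Finset.mul_sum, Finset.sum_mul]
  refine Finset.sum_congr rfl fun q' _ => ?_
  rw [Finset.sum_comm]
  refine Finset.sum_congr rfl fun q _ => Finset.sum_congr rfl fun t _ => ?_
  simp

/-- A square `Kᴴ` bounded below is injective, hence onto. For `w = Kᴴ u` one has `‖w‖² = ⟨u, K w⟩ ≤
‖u‖ ‖K w‖` and `c ‖u‖² ≤ ‖w‖²`. -/
lemma sum_norm_sq_mulVec_ge {d : ℕ} {K : Matrix (Fin d) (Fin d) ℂ} {c : ℝ} (hc : 0 < c)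
    (h : ∀ u : Fin d → ℂ, c * ∑ i, ‖u i‖ ^ 2 ≤ ∑ i, ‖(Kᴴ *ᵥ u) i‖ ^ 2) (w : Fin d → ℂ) :
    c * ∑ i, ‖w i‖ ^ 2 ≤ ∑ i, ‖(K *ᵥ w) i‖ ^ 2 := by
  have hinj : Function.Injective Kᴴ.mulVecLin := by
    refine (injective_iff_map_eq_zero _).2 fun u hu => ?_
    by_contra hu0
    have h1 := h u
    have h2 : Kᴴ *ᵥ u = 0 := hu
    have h3 := mul_pos hc (sum_norm_sq_pos hu0)
    simp only [h2, Pi.zero_apply, norm_zero] at h1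
    simp at h1
    linarith
  obtain ⟨u, hu⟩ := LinearMap.surjective_of_injective hinj w
  have hu' : Kᴴ *ᵥ u = w := hu
  have h1 := h u
  rw [hu'] at h1
  have h2 : ((∑ i, ‖w i‖ ^ 2 : ℝ) : ℂ) = ∑ i, star (u i) * (K *ᵥ w) i := by
    have : star w ⬝ᵥ w = star u ⬝ᵥ (K *ᵥ w) := by
      nth_rw 1 [← hu']
      rw [Matrix.star_mulVec, Matrix.conjTranspose_conjTranspose, ← Matrix.dotProduct_mulVec]
    change _ = star u ⬝ᵥ (K *ᵥ w)
    rw [← this]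
    simp [dotProduct, ← Complex.normSq_eq_conj_mul_self, Complex.normSq_eq_norm_sq]
  have h3 := norm_sum_mul_sq_le Finset.univ (fun i => star (u i)) (K *ᵥ w)
  rw [← h2, Complex.norm_real, Real.norm_eq_abs, sq_abs] at h3
  simp only [norm_star] at h3
  have hw : 0 ≤ ∑ i, ‖w i‖ ^ 2 := by positivity
  have hKw : 0 ≤ ∑ i, ‖(K *ᵥ w) i‖ ^ 2 := by positivity
  rcases hw.eq_or_lt with h0 | h0
  · rw [← h0]
    simpa using hKw
  · generalize ∑ i, ‖w i‖ ^ 2 = a at *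
    generalize ∑ i, ‖u i‖ ^ 2 = b at *
    generalize ∑ i, ‖(K *ᵥ w) i‖ ^ 2 = e at *
    have h4 : c * a ^ 2 ≤ a * e := by nlinarith
    nlinarith

lemma re_trace_krausMap_margA_rankOne {d : ℕ} (K : Matrix (Fin d) (Fin d) ℂ)
    (v : Fin d × Fin d → ℂ) : (krausMap K (margA (rankOne v))).trace.re =
      ∑ y, ∑ i, ‖(K *ᵥ fun x => v (x, y)) i‖ ^ 2 := by
  have h : krausMap K (margA (rankOne v)) = ∑ y, rankOne (K *ᵥ fun x => v (x, y)) := by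
    rw [margA, map_sum]
    refine Finset.sum_congr rfl fun y _ => ?_
    rw [← krausMap_rankOne]
    rfl
  rw [h, Matrix.trace_sum, Complex.re_sum]
  simp only [re_trace_rankOne]

/-- The weight outside `Ψ₊` is additive over Alice's outcomes, so each outcome is treated alone, by
the size of her reduced output `Kᵢ ρ_A Kᵢᴴ`; the two entries of `δ` belong to the two cases. -/
lemma hasGap_aliceToBob {d : ℕ} [NeZero d] {ρ : Matrix (Fin d × Fin d) (Fin d × Fin d) ℂ}
    (hρ : IsState ρ) (hmix : IsStrictlyMixed ρ) (k : OpKind) : HasGap (.oneWayFrom .alice) k ρ := by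
  obtain ⟨χ, h0, hdet⟩ := exists_det_eq_zero_of_isStrictlyMixed hρ hmix
  obtain ⟨r, hr, hle⟩ := exists_smul_rankOne_le hρ.1 χ
  set φ := ρ *ᵥ χ with hφ
  have hd : (0 : ℝ) < d := Nat.cast_pos.2 (NeZero.pos d)
  have hs := sum_norm_sq_pos h0
  set s := ∑ i, ‖φ i‖ ^ 2 with hsdef
  let δ := min (1 / (2 * (d : ℝ) ^ 2)) (r * (1 / (d : ℝ) ^ 2 * (1 / (4 * (d : ℝ) ^ 2) * s)))
  have hδ : 0 < δ := lt_min (by positivity) (by positivity)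
  refine ⟨δ, hδ, ?_⟩
  rintro Λ ⟨n, m, K, L, -, hL, rfl⟩
  rw [LinearMap.sum_apply, Matrix.trace_sum, Complex.re_sum, Finset.mul_sum, deficit_sum]
  refine Finset.sum_le_sum fun i _ => ?_
  have hsep : IsSeparableMap (∑ j, krausMap (K i ⊗ₖ L i j)) :=
    isSeparableMap_of_fintype (fun _ => K i) (L i)
  have hpos := hsep.posSemidef hρ.1
  have hmarg : ∀ X, margA ((∑ j, krausMap (K i ⊗ₖ L i j)) X) = krausMap (K i) (margA X) :=
    fun X => by
      rw [LinearMap.sum_apply]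
      exact margA_sum_krausMap (K i) (L i) (hL i) X
  generalize hΛ : (∑ j, krausMap (K i ⊗ₖ L i j)) = Λ at *
  have ht := hpos.re_trace_nonneg
  rcases ht.eq_or_lt with ht0 | ht0
  · rw [← ht0, mul_zero]
    exact deficit_nonneg hpos
  -- The threshold `1 / (4 d²)` is chosen so that the loss `2 ⟨u, · u⟩` in `le_deficit` uses up at
  -- most half of its leading `1 / d²`.
  by_cases hcase : ∃ u : Fin d → ℂ, ∑ i, ‖u i‖ ^ 2 = 1 ∧
      quad u (margA (Λ ρ)) < 1 / (4 * (d : ℝ) ^ 2) * (Λ ρ).trace.re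
  · obtain ⟨u, hu, hlt⟩ := hcase
    have h1 := le_deficit hu hpos
    have h2 : δ * (Λ ρ).trace.re ≤ 1 / (2 * (d : ℝ) ^ 2) * (Λ ρ).trace.re := by
      gcongr
      exact min_le_left _ _
    have h3 : 1 / (d : ℝ) ^ 2 * (Λ ρ).trace.re - 2 * (1 / (4 * (d : ℝ) ^ 2) * (Λ ρ).trace.re) =
        1 / (2 * (d : ℝ) ^ 2) * (Λ ρ).trace.re := by
      field_simp
      ring
    linarith
  · push Not at hcase
    set ε := 1 / (4 * (d : ℝ) ^ 2) * (Λ ρ).trace.re with hε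
    have hε0 : 0 < ε := by positivity
    -- Since `ρ_A ≤ 1`, a lower bound on `Kᵢ ρ_A Kᵢᴴ` is one on `Kᵢ Kᵢᴴ`. It passes to `Kᵢᴴ Kᵢ` and
    -- so to the probability of the outcome on `φ`.
    have hK : ∀ u : Fin d → ℂ, ε * ∑ x, ‖u x‖ ^ 2 ≤ ∑ x, ‖((K i)ᴴ *ᵥ u) x‖ ^ 2 := by
      have hunit : ∀ u : Fin d → ℂ, ∑ x, ‖u x‖ ^ 2 = 1 →
          ε ≤ ∑ x, ‖((K i)ᴴ *ᵥ u) x‖ ^ 2 := fun u hu => by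
        refine (hcase u hu).trans ?_
        have h1 := hρ.1.margA.quad_le ((K i)ᴴ *ᵥ u)
        rw [trace_margA, hρ.2, Complex.one_re, one_mul] at h1
        rw [hmarg, quad, dotProduct_krausMap]
        exact h1
      intro u
      by_cases hu0 : u = 0
      · simp [hu0]
      · obtain ⟨c, hc⟩ := exists_smul_unit hu0
        have h1 := hunit _ hc
        rw [Matrix.mulVec_smul] at h1
        simp only [Pi.smul_apply, norm_smul, mul_pow, ← Finset.mul_sum] at h1 hc
        have h2 := sum_norm_sq_pos hu0
        have h3 := mul_le_mul_of_nonneg_right h1 h2.le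
        calc _ ≤ _ := h3
          _ = (‖c‖ ^ 2 * ∑ x, ‖u x‖ ^ 2) * ∑ x, ‖((K i)ᴴ *ᵥ u) x‖ ^ 2 := by ring
          _ = _ := by rw [hc, one_mul]
    have hK' := sum_norm_sq_mulVec_ge hε0 hK
    have h1 := smul_deficit_le hsep hle
    have h2 := hsep.le_deficit hdet
    have h3 : ε * s ≤ (Λ (rankOne φ)).trace.re := by
      rw [← trace_margA, hmarg, re_trace_krausMap_margA_rankOne, hsdef, Fintype.sum_prod_type_right,
        Finset.mul_sum]
      exact Finset.sum_le_sum fun y _ => hK' fun x => φ (x, y)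
    calc δ * (Λ ρ).trace.re
        ≤ r * (1 / (d : ℝ) ^ 2 * (1 / (4 * (d : ℝ) ^ 2) * s)) * (Λ ρ).trace.re := by
          gcongr
          exact min_le_right _ _
      _ = r * (1 / (d : ℝ) ^ 2 * (ε * s)) := by
          rw [hε]
          ring
      _ ≤ r * (1 / (d : ℝ) ^ 2 * (Λ (rankOne φ)).trace.re) := by gcongr
      _ ≤ r * deficit (Λ (rankOne φ)) := by gcongr
      _ ≤ _ := h1

/-! ### Exchanging the parties -/

lemma IsState.neZero {d : ℕ} {ρ : Matrix (Fin d × Fin d) (Fin d × Fin d) ℂ} (hρ : IsState ρ) :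
    NeZero d := by
  refine ⟨?_⟩
  rintro rfl
  simpa [Matrix.trace] using hρ.2

lemma IsState.swapMat {d : ℕ} {ρ : Matrix (Fin d × Fin d) (Fin d × Fin d) ℂ} (hρ : IsState ρ) :
    IsState (swapMat _ _ ρ) :=
  ⟨hρ.1.submatrix Prod.swap, by rw [trace_swapMat, hρ.2]⟩

lemma IsStrictlyMixed.swapMat {d : ℕ} {ρ : Matrix (Fin d × Fin d) (Fin d × Fin d) ℂ}
    (hρ : IsStrictlyMixed ρ) : IsStrictlyMixed (swapMat _ _ ρ) := by
  intro ψ h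
  refine hρ (ψ ∘ Prod.swap) ?_
  rw [← swapMat_swapMat ρ, h]
  rfl

/-! ### The optimal quantities -/

lemma singletFractions_nonempty (c : Comm) (k : OpKind) {d : ℕ}
    {ρ : Matrix (Fin d × Fin d) (Fin d × Fin d) ℂ} (hρ : IsState ρ) :
    (singletFractions c k ρ).Nonempty := by
  refine ⟨_, krausMap ((1 : Matrix (Fin d) (Fin d) ℂ) ⊗ₖ 1), isLOCC_isometry 1 (by simp), ?_, rfl⟩
  simp [hρ.2]

lemma le_of_mem_singletFractions {c : Comm} {k : OpKind} {d : ℕ}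
    {ρ : Matrix (Fin d × Fin d) (Fin d × Fin d) ℂ} {δ : ℝ}
    (h : ∀ Λ : BiMap (Fin d) (Fin d) (Fin d) (Fin d), IsLOCC c k Λ →
      δ * (Λ ρ).trace.re ≤ deficit (Λ ρ)) {x : ℝ} (hx : x ∈ singletFractions c k ρ) :
    x ≤ 1 - δ := by
  obtain ⟨Λ, hΛ, htr, rfl⟩ := hx
  rw [div_le_iff₀ htr]
  have := h Λ hΛ
  rw [deficit] at this
  linarith

lemma isLUB_optSingletFraction (c : Comm) (k : OpKind) {d : ℕ}
    {ρ : Matrix (Fin d × Fin d) (Fin d × Fin d) ℂ} (hρ : IsState ρ) :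
    IsLUB (singletFractions c k ρ) (optSingletFraction c k ρ) := by
  have := hρ.neZero
  -- Boundedness by one is the case of a gap of size `0`.
  refine isLUB_csSup (singletFractions_nonempty c k hρ) ⟨1 - 0, fun x hx =>
    le_of_mem_singletFractions (fun Λ hΛ => ?_) hx⟩
  rw [zero_mul]
  exact deficit_nonneg (hΛ.isSeparableMap.posSemidef hρ.1)

lemma HasGap.optSingletFraction_lt {c : Comm} {k : OpKind} {d : ℕ}
    {ρ : Matrix (Fin d × Fin d) (Fin d × Fin d) ℂ} (h : HasGap c k ρ) (hρ : IsState ρ) :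
    optSingletFraction c k ρ < 1 := by
  obtain ⟨δ, hδ, h⟩ := h
  refine lt_of_le_of_lt ((isLUB_optSingletFraction c k hρ).2
    fun x hx => le_of_mem_singletFractions h hx) (by linarith)

/-- Supplies a protocol in every class, including those where the sender cannot speak: Alice
discards all she has and Bob keeps his part. -/
lemma exists_isLOCC_discard (c : Comm) (k : OpKind) (d : ℕ) [NeZero d] :
    ∃ T : BiMap (Fin d × Fin d) (Fin d) Unit (Fin d), IsLOCC c k T ∧
      ∀ σ, (telChoi T σ).trace = σ.trace := by
  have h : ∀ k, IsLOCC c k (∑ r : Fin d × Fin d,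
      krausMap ((Matrix.of fun _ p => if p = r then 1 else 0 : Matrix Unit (Fin d × Fin d) ℂ) ⊗ₖ
        (1 : Matrix (Fin d) (Fin d) ℂ))) := by
    refine fun k => isLOCC_local _ ?_
    ext p q
    simp only [Matrix.sum_apply, Matrix.mul_apply, Matrix.conjTranspose_apply, Matrix.of_apply,
      Matrix.one_apply, Finset.univ_unique, Finset.sum_singleton]
    rw [Finset.sum_eq_single q (fun r _ hr => by simp [hr.symm]) (by simp)]
    by_cases hpq : p = q <;> simp [hpq]
  refine ⟨_, h k, fun σ => ?_⟩
  rw [telChoi_eq]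
  exact (isLOCC_telChoi (h .tracePreserving)).trace_eq σ

/-- Fidelity of teleportation in terms of the singlet fraction. -/
def fidelityOf (d : ℕ) (F : ℝ) : ℝ := (d * F + 1) / (d + 1)

lemma fidelityOf_le {d : ℕ} {F G : ℝ} (h : F ≤ G) : fidelityOf d F ≤ fidelityOf d G := by
  unfold fidelityOf
  gcongr

lemma fidelityOf_lt_one {d : ℕ} [NeZero d] {F : ℝ} (h : F < 1) : fidelityOf d F < 1 := by
  have hd : (0 : ℝ) < d := Nat.cast_pos.2 (NeZero.pos d)
  rw [fidelityOf, div_lt_one (by positivity)]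
  nlinarith

lemma telFidelity_alice_eq {d : ℕ} [NeZero d] (σ : Matrix (Fin d × Fin d) (Fin d × Fin d) ℂ)
    (T : BiMap (Fin d × Fin d) (Fin d) Unit (Fin d)) (h : 0 < (telChoi T σ).trace.re) :
    telFidelity σ .alice T =
      fidelityOf d (singletFraction (telChoi T σ) / (telChoi T σ).trace.re) := by
  rw [telFidelity_alice, fidelityOf]
  field_simp
  ring

lemma le_of_mem_telFidelities_alice {c : Comm} {k : OpKind} {d : ℕ}
    {ρ : Matrix (Fin d × Fin d) (Fin d × Fin d) ℂ} (hρ : IsState ρ) {x : ℝ}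
    (hx : x ∈ telFidelities c k .alice ρ) : x ≤ fidelityOf d (optSingletFraction c k ρ) := by
  have := hρ.neZero
  obtain ⟨T, hT, hp, rfl⟩ := hx
  change BiMap (Fin d × Fin d) (Fin d) Unit (Fin d) at T
  rw [telProb_alice] at hp
  rw [telFidelity_alice_eq _ _ hp]
  refine fidelityOf_le ((isLUB_optSingletFraction c k hρ).1 ⟨_, isLOCC_telChoi hT, ?_, ?_⟩)
  · rwa [← telChoi_eq]
  · rw [← telChoi_eq]

lemma telFidelities_alice_nonempty (c : Comm) (k : OpKind) {d : ℕ}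
    {ρ : Matrix (Fin d × Fin d) (Fin d × Fin d) ℂ} (hρ : IsState ρ) :
    (telFidelities c k .alice ρ).Nonempty := by
  have := hρ.neZero
  obtain ⟨T, hT, htr⟩ := exists_isLOCC_discard c k d
  refine ⟨_, T, hT, ?_, rfl⟩
  rw [telProb_alice, htr, hρ.2]
  exact one_pos

lemma le_of_mem_telFidelities {c : Comm} {k : OpKind} {s : Party} {d : ℕ}
    {ρ : Matrix (Fin d × Fin d) (Fin d × Fin d) ℂ} (hρ : IsState ρ) {x : ℝ}
    (hx : x ∈ telFidelities c k s ρ) : x ≤ fidelityOf d (optSingletFraction c k ρ) := by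
  cases s with
  | alice => exact le_of_mem_telFidelities_alice hρ hx
  | bob =>
    rw [telFidelities_bob] at hx
    rw [← optSingletFraction_swap]
    exact le_of_mem_telFidelities_alice hρ.swapMat hx

lemma telFidelities_nonempty (c : Comm) (k : OpKind) (s : Party) {d : ℕ}
    {ρ : Matrix (Fin d × Fin d) (Fin d × Fin d) ℂ} (hρ : IsState ρ) :
    (telFidelities c k s ρ).Nonempty := by
  cases s with
  | alice => exact telFidelities_alice_nonempty c k hρ
  | bob =>
    rw [telFidelities_bob]
    exact telFidelities_alice_nonempty _ k hρ.swapMat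

lemma isLUB_optTelFidelity (c : Comm) (k : OpKind) (s : Party) {d : ℕ}
    {ρ : Matrix (Fin d × Fin d) (Fin d × Fin d) ℂ} (hρ : IsState ρ) :
    IsLUB (telFidelities c k s ρ) (optTelFidelity c k s ρ) :=
  isLUB_csSup (telFidelities_nonempty c k s hρ) ⟨_, fun _ hx => le_of_mem_telFidelities hρ hx⟩

lemma optTelFidelity_le (c : Comm) (k : OpKind) (s : Party) {d : ℕ}
    {ρ : Matrix (Fin d × Fin d) (Fin d × Fin d) ℂ} (hρ : IsState ρ) :
    optTelFidelity c k s ρ ≤ fidelityOf d (optSingletFraction c k ρ) :=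
  (isLUB_optTelFidelity c k s hρ).2 fun _ hx => le_of_mem_telFidelities hρ hx

lemma fidelityOf_mem_telFidelities_alice {c : Comm} {k : OpKind} {d : ℕ}
    (hc : c = .twoWay ∨ c = .oneWayFrom .alice)
    {ρ : Matrix (Fin d × Fin d) (Fin d × Fin d) ℂ} (hρ : IsState ρ) {F : ℝ}
    (hF : F ∈ singletFractions c k ρ) : fidelityOf d F ∈ telFidelities c k .alice ρ := by
  have := hρ.neZero
  obtain ⟨Λ, hΛ, htr, rfl⟩ := hF
  obtain ⟨T, hT, h⟩ := exists_teleportation d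
  have hp : 0 < (telChoi (T ∘ₗ ampMap (Fin d) Λ) ρ).trace.re := by
    rwa [telChoi_comp_ampMap, (h _).1]
  refine ⟨T ∘ₗ ampMap (Fin d) Λ, IsLOCC.comp (.of_isAliceToBob hc (hT k)) hΛ.ampMap, ?_, ?_⟩
  · rwa [telProb_alice]
  · rw [telFidelity_alice_eq _ _ hp, telChoi_comp_ampMap, (h _).1, (h _).2]

lemma fidelityOf_mem_telFidelities {c : Comm} {k : OpKind} {s : Party} {d : ℕ}
    (hc : c = .twoWay ∨ c = .oneWayFrom s)
    {ρ : Matrix (Fin d × Fin d) (Fin d × Fin d) ℂ} (hρ : IsState ρ) {F : ℝ}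
    (hF : F ∈ singletFractions c k ρ) : fidelityOf d F ∈ telFidelities c k s ρ := by
  cases s with
  | alice => exact fidelityOf_mem_telFidelities_alice hc hρ hF
  | bob =>
    rw [telFidelities_bob]
    rw [← singletFractions_swap] at hF
    exact fidelityOf_mem_telFidelities_alice (by rcases hc with rfl | rfl <;> simp [Comm.swap,
      Party.swap]) hρ.swapMat hF

lemma optTelFidelity_eq {c : Comm} (k : OpKind) {s : Party} {d : ℕ}
    (hc : c = .twoWay ∨ c = .oneWayFrom s)
    {ρ : Matrix (Fin d × Fin d) (Fin d × Fin d) ℂ} (hρ : IsState ρ) :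
    optTelFidelity c k s ρ = fidelityOf d (optSingletFraction c k ρ) := by
  have := hρ.neZero
  have hd : (0 : ℝ) < d := Nat.cast_pos.2 (NeZero.pos d)
  refine le_antisymm (optTelFidelity_le c k s hρ) ?_
  -- The increasing affine map `fidelityOf d` is inverted, so that the supremum can be taken on the
  -- side of the singlet fractions.
  have h : optSingletFraction c k ρ ≤ ((d + 1) * optTelFidelity c k s ρ - 1) / d := by
    refine (isLUB_optSingletFraction c k hρ).2 fun F hF => ?_
    have h := (isLUB_optTelFidelity c k s hρ).1 (fidelityOf_mem_telFidelities hc hρ hF)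
    rw [fidelityOf, div_le_iff₀ (by positivity)] at h
    rw [le_div_iff₀ hd]
    linarith
  rw [le_div_iff₀ hd] at h
  rw [fidelityOf, div_le_iff₀ (by positivity)]
  linarith

lemma optSingletFraction_lt_one {c : Comm} {k : OpKind} {d : ℕ}
    {ρ : Matrix (Fin d × Fin d) (Fin d × Fin d) ℂ} (hρ : IsState ρ) (hmix : IsStrictlyMixed ρ)
    (h : ρ.PosDef ∨ k = .tracePreserving ∨ ∃ r : Party, c = .oneWayFrom r) :
    optSingletFraction c k ρ < 1 := by
  have := hρ.neZero
  rcases h with h | rfl | ⟨_ | _, rfl⟩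
  · exact (hasGap_posDef hρ hmix h c k).optSingletFraction_lt hρ
  · exact (hasGap_tracePreserving hρ hmix c).optSingletFraction_lt hρ
  · exact (hasGap_aliceToBob hρ hmix k).optSingletFraction_lt hρ
  · rw [← optSingletFraction_swap]
    exact (hasGap_aliceToBob hρ.swapMat hmix.swapMat k).optSingletFraction_lt hρ.swapMat

end

theorem mainTheorem4 {d : ℕ} (ρ : Matrix (Fin d × Fin d) (Fin d × Fin d) ℂ) (hρ : IsState ρ) :
    -- twirling lies in every class, and following an operation by it does not change its class
    (∀ (c : Comm) (k : OpKind), IsLOCC c k (twirl d) ∧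
      ∀ (a b : Type) [Fintype a] [Fintype b] [DecidableEq a] [DecidableEq b]
        (Λ : BiMap a b (Fin d) (Fin d)), IsLOCC c k Λ → IsLOCC c k (twirl d ∘ₗ Λ)) ∧
    -- the optimal quantities are genuine suprema
    (∀ (c : Comm) (k : OpKind),
      IsLUB (singletFractions c k ρ) (optSingletFraction c k ρ) ∧
      ∀ s : Party, IsLUB (telFidelities c k s ρ) (optTelFidelity c k s ρ)) ∧
    -- the formula, when the sender of the unknown state may send classical messages
    (∀ (k : OpKind) (s : Party) (c : Comm), c = .twoWay ∨ c = .oneWayFrom s →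
      optTelFidelity c k s ρ = (d * optSingletFraction c k ρ + 1) / (d + 1)) ∧
    -- every threshold for the singlet fraction gives one for the teleportation fidelity
    (∀ (c : Comm) (k : OpKind) (s : Party) (Fth : ℝ),
      optSingletFraction c k ρ ≤ Fth → Fth < 1 →
        optTelFidelity c k s ρ ≤ (d * optSingletFraction c k ρ + 1) / (d + 1) ∧
        (d * optSingletFraction c k ρ + 1) / (d + 1) ≤ (d * Fth + 1) / (d + 1) ∧
        (d * Fth + 1) / (d + 1) < 1) ∧
    -- the cases in which there is a threshold
    (IsStrictlyMixed ρ →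
      ∀ (c : Comm) (k : OpKind),
        (ρ.PosDef ∨ k = .tracePreserving ∨ ∃ r : Party, c = .oneWayFrom r) →
          ∃ Fth : ℝ, Fth < 1 ∧ optSingletFraction c k ρ ≤ Fth ∧
            ∀ s : Party, optTelFidelity c k s ρ ≤ (d * Fth + 1) / (d + 1) ∧
              (d * Fth + 1) / (d + 1) < 1) ∧
    -- arbitrarily good teleportation through a mixed state needs backward communication
    (IsStrictlyMixed ρ →
      ∀ s : Party, ∃ fth : ℝ, fth < 1 ∧
        ∀ T : TelMap d s, IsTelLOCC .twoWay .conclusive s T → 0 < telProb ρ s T →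
          fth < telFidelity ρ s T → ¬ IsTelLOCC (.oneWayFrom s) .conclusive s T) := by
  have := hρ.neZero
  refine ⟨fun c k => ⟨isLOCC_twirl c k d, fun a b _ _ _ _ Λ hΛ => (isLOCC_twirl c k d).comp hΛ⟩,
    fun c k => ⟨isLUB_optSingletFraction c k hρ, fun s => isLUB_optTelFidelity c k s hρ⟩,
    fun k s c hc => optTelFidelity_eq k hc hρ,
    fun c k s F hF h1 => ⟨optTelFidelity_le c k s hρ, fidelityOf_le hF, fidelityOf_lt_one h1⟩,
    fun hmix c k h => ?_, fun hmix s => ?_⟩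
  · have hF := optSingletFraction_lt_one hρ hmix h
    exact ⟨_, hF, le_rfl, fun s => ⟨optTelFidelity_le c k s hρ, fidelityOf_lt_one hF⟩⟩
  · have hF := optSingletFraction_lt_one (c := .oneWayFrom s) (k := .conclusive) hρ hmix
      (.inr (.inr ⟨s, rfl⟩))
    -- The threshold is the bound for conclusive one-way protocols from `s`; a two-way protocol
    -- exceeding it cannot be one of them.
    refine ⟨_, fidelityOf_lt_one (d := d) hF, fun T _ hp hlt hT => hlt.not_ge ?_⟩
    exact le_of_mem_telFidelities hρ ⟨T, hT, hp, rfl⟩
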